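/- **Lemma (Bounding commutators by Dirichlet forms).** Setting. Let $H=\sum_{\gamma\in\Gamma}H_\gamma$ be a finite sum of Hermitian operators with $\|H_\gamma\|\le 1$ ($\|\cdot\|$ is the operator norm) on a finite set of qubits. Its interaction graph has vertex set $\Gamma$, with $\gamma\sim\gamma'$ iff $\operatorname{Supp}(H_\gamma)\cap\operatorname{Supp}(H_{\gamma'})\neq\emptyset$ (self-loops are allowed and counted). Let $d\ge 1$ be an integer that bounds its maximal degree. For $\beta>0$ put $\rho_\beta=e^{-\beta H}/\operatorname{Tr}e^{-\beta H}$, $\langle X,Y\rangle_{\rho}=\operatorname{Tr}[X^\dagger\rho^{1/2}Y\rho^{1/2}]$ and $\|X\|_\rho=\sqrt{\langle X,X\rangle_\rho}$. For $\sigma>0$ let $f(t)=e^{-\sigma^2t^2}\sqrt{\sigma\sqrt{2/\pi}}$, $\hat f(\omega)=\frac{1}{\sqrt{\sigma\sqrt{2\pi}}}e^{-\omega^2/4\sigma^2}$, $$\hat A(\omega)=\frac1{\sqrt{2\pi}}\int_{-\infty}^{\infty}e^{iHt}Ae^{-iHt}e^{-i\omega t}f(t)\,dt,\qquad \gamma(\omega)=\exp\!\big(-\beta\max(\omega+\tfrac{\beta\sigma^2}{2},0)\big).$$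 For a Hermitian jump $A$ let $\mathcal L$ be the exactly $\rho_\beta$-detailed-balanced Lindbladian with Metropolis weight $\gamma$ and unique jump $A$, $$\mathcal L[X]=-i[B,X]+\int_{-\infty}^{\infty}\gamma(\omega)\Big(\hat A(\omega)X\hat A(\omega)^\dagger-\tfrac12\{\hat A(\omega)^\dagger\hat A(\omega),X\}\Big)d\omega,$$ $$B=\sum_{\nu_1,\nu_2}\frac{\tanh(-\beta(\nu_1-\nu_2)/4)}{2i}\,\alpha_{\nu_1,\nu_2}\,A_{\nu_2}^\dagger A_{\nu_1},\qquad \alpha_{\nu_1,\nu_2}=\int_{-\infty}^{\infty}\gamma(\omega)\hat f(\omega-\nu_1)\hat f(\omega-\nu_2)\,d\omega,$$ where $\nu_1,\nu_2$ run over the differences of eigenvalues of $H$, $A_\nu=\sum_{E_2-E_1=\nu}P_{E_2}AP_{E_1}$, and $P_E$ is the spectral projector of $H$ at $E$. Let $\mathcal E(O)=-\langle O,\mathcal L^\dagger[O]\rangle_{\rho_\beta}$, with $\mathcal L^\dagger$ the Hilbert–Schmidt adjoint of $\mathcal L$; let $|A|$ be the number of qubits in the support of $A$, and $g(t)=\frac{1}{\beta\cosh(2\pi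 t/\beta)}$. Claim. There is an absolute constant $C>0$ such that, for all such $H$, $d$, all $\beta,\beta_0,\sigma>0$, every Hermitian $A$ and every operator $O$ with $\|A\|,\|O\|\le 1$, the number $\mathcal E(O)$ is real and nonnegative and $$\big\|[A,O]\big\|_{\rho_\beta}\le C\,d^2|A|\left(\frac{e^{\sigma^2\beta_0^2}}{\beta_0\sigma}+\frac{e^{\sigma^2\beta^2/16}}{\sqrt{g(1)\beta\sigma}}\right)^{\frac{\beta+4\beta_0}{\beta+5\beta_0}}\Big(\|\rho_{\beta_0}A\rho_{\beta_0}^{-1}\|+\|\rho_{\beta_0}^{-1}A\rho_{\beta_0}\|\Big)^{\frac{\beta}{\beta+5\beta_0}}\mathcal E(O)^{\frac{2\beta_0}{\beta+5\beta_0}}.$$ -/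

import Mathlib

open scoped Matrix.Norms.L2Operator MatrixOrder ComplexOrder

noncomputable section

namespace GibbsSampler

/-! ### Qubits, supports and Hamiltonians of bounded interaction degree -/

/-- Operators on the qubits labelled by `Λ`, as matrices in the computational basis
`Λ → Fin 2`. The norm `‖·‖` on this type is the operator (spectral) norm. -/
abbrev QubitOp (Λ : Type*) := Matrix (Λ → Fin 2) (Λ → Fin 2) ℂ

section Support

variable {Λ : Type*} [Fintype Λ] [DecidableEq Λ]

/-- `A` acts as the identity on qubit `i`: it is of the form `1 ⊗ A'`, where `1` acts on qubit `i`
and `A'` on the other qubits. In the computational basis: matrix elements between configurations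
that differ at `i` vanish, and the other ones do not depend on the common value at `i`. -/
def ActsTriviallyAt (A : QubitOp Λ) (i : Λ) : Prop :=
  (∀ x y : Λ → Fin 2, x i ≠ y i → A x y = 0) ∧
  (∀ (x y : Λ → Fin 2) (a : Fin 2), x i = y i →
    A (Function.update x i a) (Function.update y i a) = A x y)

open scoped Classical in
/-- The support of an operator: the qubits on which it acts nontrivially. -/
def opSupport (A : QubitOp Λ) : Finset Λ :=
  Finset.univ.filter fun i => ¬ ActsTriviallyAt A i

end Support

/-- A Hamiltonian `H = ∑ γ, H_γ` on the qubits `Λ`, with Hermitian terms of norm at most one. -/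
structure LocalHamiltonian (Λ Γ : Type*) [Fintype Λ] [DecidableEq Λ] where
  term : Γ → QubitOp Λ
  isHermitian_term : ∀ γ, (term γ).IsHermitian
  norm_term_le_one : ∀ γ, ‖term γ‖ ≤ 1

namespace LocalHamiltonian

variable {Λ Γ : Type*} [Fintype Λ] [DecidableEq Λ] [Fintype Γ]

/-- The total Hamiltonian. -/
def total (h : LocalHamiltonian Λ Γ) : QubitOp Λ := ∑ γ, h.term γ

theorem isHermitian_total (h : LocalHamiltonian Λ Γ) : h.total.IsHermitian := by
  unfold LocalHamiltonian.total Matrix.IsHermitian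
  rw [Matrix.conjTranspose_sum]
  exact Finset.sum_congr rfl fun γ _ => h.isHermitian_term γ

/-- The maximal degree of the interaction graph, whose vertices are the terms; `γ ∼ γ'` if and
only if their supports intersect (so a vertex with nonempty support has a self-loop, which
is counted). -/
def interactionDegree (h : LocalHamiltonian Λ Γ) : ℕ :=
  Finset.univ.sup fun γ : Γ =>
    (Finset.univ.filter fun γ' : Γ =>
      (opSupport (h.term γ) ∩ opSupport (h.term γ')).Nonempty).card

end LocalHamiltonian

section Matrices

variable {m : Type*} [Fintype m] [DecidableEq m]

/-! ### Gibbs states and the KMS inner product -/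

/-- The Gibbs state `ρ_β = e^{-βH} / Tr e^{-βH}`. -/
def gibbs (H : Matrix m m ℂ) (β : ℝ) : Matrix m m ℂ :=
  (NormedSpace.exp (-(β : ℂ) • H)).trace⁻¹ • NormedSpace.exp (-(β : ℂ) • H)

/-- The KMS inner product `⟨X, Y⟩_ρ = Tr[X† ρ^{1/2} Y ρ^{1/2}]`. -/
def kmsInner (ρ X Y : Matrix m m ℂ) : ℂ :=
  (X.conjTranspose * CFC.sqrt ρ * Y * CFC.sqrt ρ).trace

/-- The weighted norm induced by the KMS inner product. -/
def kmsNorm (ρ X : Matrix m m ℂ) : ℝ := √(kmsInner ρ X X).re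

/-! ### The operator Fourier transform -/

/-- The Gaussian filter `f(t) = e^{-σ²t²} √(σ √(2/π))`. -/
def filterTime (σ t : ℝ) : ℝ := Real.exp (-(σ ^ 2 * t ^ 2)) * √(σ * √(2 / Real.pi))

/-- Its Fourier transform, `f̂(ω) = e^{-ω²/(4σ²)} / √(σ √(2π))`. -/
def filterFreq (σ ω : ℝ) : ℝ :=
  1 / √(σ * √(2 * Real.pi)) * Real.exp (-(ω ^ 2 / (4 * σ ^ 2)))

/-- Heisenberg evolution `A(t) = e^{iHt} A e^{-iHt}`. -/
def heisenberg (H A : Matrix m m ℂ) (t : ℝ) : Matrix m m ℂ :=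
  NormedSpace.exp ((Complex.I * t) • H) * A * NormedSpace.exp (-(Complex.I * t) • H)

/-- The operator Fourier transform `Â(ω) = (2π)^{-1/2} ∫ A(t) e^{-iωt} f(t) dt`. -/
def opFT (H : Matrix m m ℂ) (σ : ℝ) (A : Matrix m m ℂ) (ω : ℝ) : Matrix m m ℂ :=
  ((1 / √(2 * Real.pi) : ℝ) : ℂ) •
    ∫ t : ℝ, (Complex.exp (-(Complex.I * ω * t)) * (filterTime σ t : ℂ)) • heisenberg H A t

/-- The Metropolis weight `γ(ω) = exp(-β max(ω + βσ²/2, 0))`. -/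
def metropolis (β σ ω : ℝ) : ℝ := Real.exp (-(β * max (ω + β * σ ^ 2 / 2) 0))

/-! ### Bohr frequencies and the coherent term -/

/-- The spectral projector `P_E = ∑_{i : E_i = E} |ψ_i⟩⟨ψ_i|` of `H = ∑_i E_i |ψ_i⟩⟨ψ_i|`. -/
def spectralProj {H : Matrix m m ℂ} (hH : H.IsHermitian) (E : ℝ) : Matrix m m ℂ :=
  ∑ i : m with hH.eigenvalues i = E,
    Matrix.of fun x y => hH.eigenvectorBasis i x * star (hH.eigenvectorBasis i y)

/-- The set of energies. -/
def energies {H : Matrix m m ℂ} (hH : H.IsHermitian) : Finset ℝ :=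
  Finset.univ.image hH.eigenvalues

/-- The set of Bohr frequencies, i.e. of energy differences. -/
def bohrFreqs {H : Matrix m m ℂ} (hH : H.IsHermitian) : Finset ℝ :=
  (energies hH ×ˢ energies hH).image fun p => p.1 - p.2

/-- `A_ν = ∑_{E₂ - E₁ = ν} P_{E₂} A P_{E₁}`. -/
def bohrComponent {H : Matrix m m ℂ} (hH : H.IsHermitian) (A : Matrix m m ℂ) (ν : ℝ) :
    Matrix m m ℂ :=
  ∑ p ∈ energies hH ×ˢ energies hH with p.1 - p.2 = ν,
    spectralProj hH p.1 * A * spectralProj hH p.2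

/-- The coefficients `α_{ν₁,ν₂}` of the transition part
`∫ γ(ω) Â(ω) (·) Â(ω)† dω = ∑_{ν₁,ν₂} α_{ν₁,ν₂} A_{ν₁} (·) A_{ν₂}†`. -/
def transitionCoeff (β σ ν₁ ν₂ : ℝ) : ℝ :=
  ∫ ω : ℝ, metropolis β σ ω * filterFreq σ (ω - ν₁) * filterFreq σ (ω - ν₂)

/-- The coherent term of the exactly detailed-balanced Lindbladian with the jump `A`,
`B = ∑_{ν₁,ν₂} (tanh(-β(ν₁-ν₂)/4) / (2i)) α_{ν₁,ν₂} A_{ν₂}† A_{ν₁}`. -/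
def coherentTerm {H : Matrix m m ℂ} (hH : H.IsHermitian) (β σ : ℝ) (A : Matrix m m ℂ) :
    Matrix m m ℂ :=
  ∑ ν₁ ∈ bohrFreqs hH, ∑ ν₂ ∈ bohrFreqs hH,
    ((Real.tanh (-(β * (ν₁ - ν₂) / 4)) * transitionCoeff β σ ν₁ ν₂ : ℝ) / (2 * Complex.I) : ℂ) •
      ((bohrComponent hH A ν₂).conjTranspose * bohrComponent hH A ν₁)

/-! ### The Lindbladian and its Dirichlet form -/

/-- The Lindbladian with the unique jump `A` and the Metropolis weight (Schrödinger picture),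
`ℒ[X] = -i[B, X] + ∫ γ(ω) (Â(ω) X Â(ω)† - ½ {Â(ω)† Â(ω), X}) dω`. -/
def lindbladian {H : Matrix m m ℂ} (hH : H.IsHermitian) (β σ : ℝ) (A X : Matrix m m ℂ) :
    Matrix m m ℂ :=
  -Complex.I • (coherentTerm hH β σ A * X - X * coherentTerm hH β σ A) +
    ∫ ω : ℝ, (metropolis β σ ω : ℂ) •
      (opFT H σ A ω * X * (opFT H σ A ω).conjTranspose -
        (1 / 2 : ℂ) • ((opFT H σ A ω).conjTranspose * opFT H σ A ω * X +
          X * ((opFT H σ A ω).conjTranspose * opFT H σ A ω)))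

/-- The adjoint `Φ†` of a linear superoperator `Φ` for the Hilbert-Schmidt inner product
`Tr[X† Y]`: its matrix elements are `Φ†[Y]_{ij} = Tr[Φ[|i⟩⟨j|]† Y]`. -/
def hsAdjoint (Φ : Matrix m m ℂ → Matrix m m ℂ) (Y : Matrix m m ℂ) : Matrix m m ℂ :=
  Matrix.of fun i j => ((Φ (Matrix.single i j 1)).conjTranspose * Y).trace

/-- `hsAdjoint` is indeed the Hilbert-Schmidt adjoint. -/
theorem trace_hsAdjoint (Φ : Matrix m m ℂ →ₗ[ℂ] Matrix m m ℂ) (X Y : Matrix m m ℂ) :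
    (X.conjTranspose * hsAdjoint Φ Y).trace = ((Φ X).conjTranspose * Y).trace := by
  have hX : Φ X = ∑ i, ∑ j, X i j • Φ (Matrix.single i j 1) := by
    conv_lhs => rw [Matrix.matrix_eq_sum_single X]
    simp only [map_sum, ← map_smul, Matrix.smul_single, smul_eq_mul, mul_one]
  rw [hX]
  simp only [Matrix.conjTranspose_sum, Matrix.conjTranspose_smul, Finset.sum_mul,
    Matrix.trace_sum, Matrix.smul_mul, Matrix.trace_smul, smul_eq_mul]
  simp only [Matrix.trace, Matrix.diag, Matrix.mul_apply, hsAdjoint, Matrix.of_apply,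
    Matrix.conjTranspose_apply]
  exact Finset.sum_comm

/-- The Dirichlet form `ℰ(X, Y) = -⟨X, ℒ†[Y]⟩_{ρ_β}` of the Lindbladian with Metropolis weight and
unique jump `A` at inverse temperature `β`. -/
def dirichletForm {H : Matrix m m ℂ} (hH : H.IsHermitian) (β σ : ℝ) (A X Y : Matrix m m ℂ) : ℂ :=
  -kmsInner (gibbs H β) X (hsAdjoint (lindbladian hH β σ A) Y)

end Matrices

/-- `g(t) = 1 / (β cosh(2πt/β))`. -/
def gKernel (β t : ℝ) : ℝ := 1 / (β * Real.cosh (2 * Real.pi * t / β))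

end GibbsSampler

end

/-! Split `A` into its Bohr components `A_ν`. The coherent term merges with the decay term, and the
Dirichlet form becomes a quadratic form in the commutators `[A_ν, O]` whose weight is `symmCoeff`
times `1 / (2 cosh (β(ν₁-ν₂)/4))`. The first factor is a superposition of the products `f̂(u-ν₁)
f̂(u-ν₂)` with density `e^{-β|u|/2}`; the second is the Fourier transform of `gKernel`. Hence `ℰ(O)
= e^{-β²σ²/8} ∫∫ e^{-β|u|/2} g(t) ‖[e^{iHt} Â(u) e^{-iHt}, O]‖² dt du`, which is visibly nonnegative
(`dirichletForm_eq_sum`, `integrable_exp_mul_energyDensity`).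

To pass from this energy to `[A, O]`, write `κ A = ∫ Â(u) du` with `κ = ∫ f̂`, average the evolution
over `|t| ≤ τ`, and cut the frequencies at `|u| ≤ Ω`. Three pieces result (`kmsNorm_commutator_le`).
The error of the time average is at most `τ² ‖[H,[H,A]]‖`, and locality bounds the double commutator
by `8 (d²|A|)²` (`FlowBounded.norm_sum_one_sub_avgCoeff_le`,
`LocalHamiltonian.norm_double_commutator_le`). The frequencies `|u| > Ω` contribute `e^{-β₀Ω}` times
the norms of `ρ_{β₀}^{±1} A ρ_{β₀}^{∓1}`, by an imaginary shift of the Gaussian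
(`FlowBounded.norm_sum_high_le`). On the remaining window the weights `e^{-β|u|/2}` and `g(t)` are
bounded below, so Cauchy–Schwarz controls it by `e^{βΩ/4} √(ℰ/τ)` (`norm_sq_low_le`).

Let `F` and `K` denote the two bracketed sums in the claim. Balancing the pieces against a target
`T` gives `T^{β+5β₀} = F^{β+4β₀} K^β ℰ^{2β₀}`, which is where the exponents come from
(`le_of_forall_cutoff_of_pos`). -/

noncomputable section

namespace GibbsSampler

open NormedSpace MeasureTheory

/-! ### Bohr components as eigenvectors of the Heisenberg flow. -/

section Spectral

variable {m : Type*} [Fintype m] [DecidableEq m] {H : Matrix m m ℂ} (hH : H.IsHermitian)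

theorem conjTranspose_spectralProj (E : ℝ) : (spectralProj hH E).conjTranspose = spectralProj hH E := by
  rw [spectralProj, Matrix.conjTranspose_sum]
  refine Finset.sum_congr rfl fun i _ => ?_
  ext x y
  simp [mul_comm]

theorem sum_spectralProj : ∑ E ∈ energies hH, spectralProj hH E = 1 := by
  unfold spectralProj energies
  rw [Finset.sum_fiberwise_of_maps_to (fun i hi => Finset.mem_image_of_mem _ hi),
    ← (Matrix.mem_unitaryGroup_iff.1 hH.eigenvectorUnitary.2)]
  ext x y
  simp [Matrix.sum_apply, Matrix.mul_apply, Matrix.star_apply]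

theorem mul_spectralProj (E : ℝ) : H * spectralProj hH E = (E : ℂ) • spectralProj hH E := by
  rw [spectralProj, Finset.mul_sum, Finset.smul_sum]
  refine Finset.sum_congr rfl fun i hi => ?_
  rw [← (Finset.mem_filter.1 hi).2]
  ext x y
  have := congrFun (hH.mulVec_eigenvectorBasis i) x
  simp only [Matrix.mulVec, dotProduct, Pi.smul_apply] at this
  simp only [Matrix.mul_apply, Matrix.of_apply, Matrix.smul_apply, ← mul_assoc, ← Finset.sum_mul,
    smul_eq_mul]
  rw [this]
  simp

theorem spectralProj_mul (E : ℝ) : spectralProj hH E * H = (E : ℂ) • spectralProj hH E := by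
  have := congrArg Matrix.conjTranspose (mul_spectralProj hH E)
  simpa [Matrix.conjTranspose_mul, conjTranspose_spectralProj, hH.eq, Matrix.conjTranspose_smul] using this

theorem sum_bohrComponent (A : Matrix m m ℂ) : ∑ ν ∈ bohrFreqs hH, bohrComponent hH A ν = A := by
  unfold bohrComponent bohrFreqs
  rw [Finset.sum_fiberwise_of_maps_to (fun x hx => Finset.mem_image_of_mem _ hx),
    Finset.sum_product]
  simp_rw [← Finset.mul_sum, ← Finset.sum_mul]
  simp [sum_spectralProj]

theorem conjTranspose_bohrComponent (A : Matrix m m ℂ) (ν : ℝ) :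
    (bohrComponent hH A ν).conjTranspose = bohrComponent hH A.conjTranspose (-ν) := by
  unfold bohrComponent
  rw [Matrix.conjTranspose_sum]
  refine Finset.sum_bij' (fun p _ => p.swap) (fun p _ => p.swap) ?_ ?_ ?_ ?_ ?_
  · simp only [Finset.mem_filter, Finset.mem_product]; rintro ⟨a, b⟩ ⟨⟨h1, h2⟩, rfl⟩; simp_all
  · simp only [Finset.mem_filter, Finset.mem_product]
    rintro ⟨a, b⟩ ⟨⟨h1, h2⟩, h⟩
    refine ⟨⟨h2, h1⟩, ?_⟩
    simp only [Prod.fst_swap, Prod.snd_swap] at h ⊢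
    linarith
  · simp
  · simp
  · intro p _
    simp [Matrix.conjTranspose_mul, conjTranspose_spectralProj, mul_assoc]

theorem neg_mem_bohrFreqs {ν : ℝ} (h : ν ∈ bohrFreqs hH) : -ν ∈ bohrFreqs hH := by
  unfold bohrFreqs at *
  simp only [Finset.mem_image, Finset.mem_product, Prod.exists] at *
  obtain ⟨a, b, ⟨h1, h2⟩, rfl⟩ := h
  exact ⟨b, a, ⟨h2, h1⟩, by ring⟩

theorem mul_bohrComponent (A : Matrix m m ℂ) (ν : ℝ) :
    H * bohrComponent hH A ν = bohrComponent hH A ν * (H + algebraMap ℂ _ (ν : ℂ)) := by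
  unfold bohrComponent
  rw [Finset.mul_sum, Finset.sum_mul]
  refine Finset.sum_congr rfl fun p hp => ?_
  have hν : (p.1 : ℂ) = p.2 + ν := by
    rw [← (Finset.mem_filter.1 hp).2]; push_cast; ring
  rw [mul_add, mul_assoc _ _ H, spectralProj_mul, ← mul_assoc, ← mul_assoc, mul_spectralProj, hν,
    ← Algebra.commutes, ← Algebra.smul_def]
  simp only [add_smul, add_mul, Matrix.smul_mul, Matrix.mul_smul]

/-- `A_ν` intertwines `zH + zν` with `zH`, hence also their exponentials. A complex `z` covers both
the unitary flow and conjugation by Gibbs states. -/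
theorem exp_mul_bohrComponent (A : Matrix m m ℂ) (ν : ℝ) (z : ℂ) :
    exp (z • H) * bohrComponent hH A ν =
      Complex.exp (z * ν) • (bohrComponent hH A ν * exp (z • H)) := by
  have h : SemiconjBy (bohrComponent hH A ν) (z • H + algebraMap ℂ _ (z * ν)) (z • H) := by
    unfold SemiconjBy
    rw [Matrix.smul_mul, mul_bohrComponent, map_mul, ← Matrix.mul_smul, smul_add, Algebra.smul_def z (algebraMap ℂ _ (ν:ℂ))]
  let : NormedAlgebra ℚ (Matrix m m ℂ) := .restrictScalars ℚ ℂ _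
  have h2 := h.exp_right
  unfold SemiconjBy at h2
  rw [← h2, Matrix.exp_add_of_commute _ _ (Algebra.commute_algebraMap_right _ _), ← algebraMap_exp_comm,
    ← Complex.exp_eq_exp_ℂ, ← Algebra.commutes, ← Algebra.smul_def, Matrix.mul_smul]

theorem exp_smul_mul_exp_smul (H : Matrix m m ℂ) (z w : ℂ) : exp (z • H) * exp (w • H) = exp ((z + w) • H) := by
  rw [add_smul, Matrix.exp_add_of_commute]
  exact ((Commute.refl H).smul_left z).smul_right w

theorem exp_conj_bohrComponent (A : Matrix m m ℂ) (ν : ℝ) (z : ℂ) :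
    exp (z • H) * bohrComponent hH A ν * exp (-z • H) =
      Complex.exp (z * ν) • bohrComponent hH A ν := by
  rw [exp_mul_bohrComponent, Matrix.smul_mul, mul_assoc, exp_smul_mul_exp_smul]
  simp

theorem exp_conj_eq_sum (A : Matrix m m ℂ) (z : ℂ) :
    exp (z • H) * A * exp (-z • H) =
      ∑ ν ∈ bohrFreqs hH, Complex.exp (z * ν) • bohrComponent hH A ν := by
  conv_lhs => rw [← sum_bohrComponent hH A]
  rw [Finset.mul_sum, Finset.sum_mul]
  exact Finset.sum_congr rfl fun ν _ => exp_conj_bohrComponent hH A ν z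

theorem heisenberg_eq_sum (A : Matrix m m ℂ) (t : ℝ) :
    heisenberg H A t = ∑ ν ∈ bohrFreqs hH, Complex.exp (Complex.I * t * ν) • bohrComponent hH A ν :=
  exp_conj_eq_sum hH A _

theorem commutator_bohrComponent (A : Matrix m m ℂ) (ν : ℝ) :
    H * bohrComponent hH A ν - bohrComponent hH A ν * H = (ν : ℂ) • bohrComponent hH A ν := by
  rw [mul_bohrComponent, mul_add, add_sub_cancel_left, ← Algebra.commutes, ← Algebra.smul_def]

end Spectral

/-! ### Gaussian filters and the symmetry of the Metropolis coefficients. -/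

section Filters

theorem filterFreq_neg (σ x : ℝ) : filterFreq σ (-x) = filterFreq σ x := by simp [filterFreq]

theorem filterFreq_nonneg (σ x : ℝ) : 0 ≤ filterFreq σ x := by unfold filterFreq; positivity

theorem filterTime_nonneg (σ x : ℝ) : 0 ≤ filterTime σ x := by unfold filterTime; positivity

theorem continuous_filterFreq (σ : ℝ) : Continuous (filterFreq σ) := by unfold filterFreq; fun_prop

theorem integrable_filterFreq {σ : ℝ} (hσ : 0 < σ) : Integrable (filterFreq σ) := by
  unfold filterFreq
  refine Integrable.const_mul ?_ _
  convert integrable_exp_neg_mul_sq (b := 1 / (4 * σ ^ 2)) (by positivity) using 3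
  ring

theorem integrable_filterTime {σ : ℝ} (hσ : 0 < σ) : Integrable (filterTime σ) := by
  unfold filterTime
  refine Integrable.mul_const ?_ _
  convert integrable_exp_neg_mul_sq (b := σ ^ 2) (by positivity) using 3
  ring

theorem filterFreq_le (σ x : ℝ) : filterFreq σ x ≤ 1 / √(σ * √(2 * Real.pi)) := by
  unfold filterFreq
  refine mul_le_of_le_one_right (by positivity) (Real.exp_le_one_iff.2 ?_)
  simp only [Left.neg_nonpos_iff]
  positivity

theorem integral_filterFreq {σ : ℝ} (hσ : 0 < σ) :
    ∫ x, filterFreq σ x = √2 * √(σ * √(2 * Real.pi)) := by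
  unfold filterFreq
  rw [integral_const_mul]
  have h : ∀ x : ℝ, -(x ^ 2 / (4 * σ ^ 2)) = -(1 / (4 * σ ^ 2)) * x ^ 2 := fun x => by ring
  simp_rw [h, integral_gaussian]
  have h1 : Real.pi / (1 / (4 * σ ^ 2)) = 2 * (σ * √(2 * Real.pi)) ^ 2 := by
    rw [mul_pow, Real.sq_sqrt (by positivity)]; field_simp; ring
  rw [h1]
  have h3 : 0 < σ * √(2 * Real.pi) := by positivity
  generalize σ * √(2 * Real.pi) = y at h3
  rw [Real.sqrt_mul zero_le_two, Real.sqrt_sq h3.le, div_mul_eq_mul_div, one_mul, mul_div_assoc, Real.div_sqrt]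

theorem integral_filterTime {σ : ℝ} (hσ : 0 < σ) :
    ∫ x, filterTime σ x = √(2 * Real.pi) / √(σ * √(2 * Real.pi)) := by
  unfold filterTime
  rw [integral_mul_const]
  have h : ∀ x : ℝ, -(σ ^ 2 * x ^ 2) = -(σ ^ 2) * x ^ 2 := fun x => by ring
  simp_rw [h, integral_gaussian]
  rw [← Real.sqrt_mul (by positivity), ← Real.sqrt_div (by positivity)]
  congr 1
  rw [Real.sqrt_div (by positivity), Real.sqrt_mul (by positivity)]
  have hp : √Real.pi ^ 2 = Real.pi := Real.sq_sqrt (by positivity)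
  have h2 : √2 ^ 2 = (2 : ℝ) := Real.sq_sqrt (by positivity)
  field_simp
  rw [h2]

theorem integral_cexp_mul_filterTime {σ : ℝ} (hσ : 0 < σ) (x : ℝ) :
    ∫ t : ℝ, Complex.exp (Complex.I * x * t) * (filterTime σ t : ℂ) =
      √(2 * Real.pi) * filterFreq σ x := by
  have h := fourierIntegral_gaussian (b := (σ ^ 2 : ℝ)) (by rw [Complex.ofReal_re]; positivity) x
  have h0 : ∀ t : ℝ, Complex.exp (Complex.I * x * t) * (filterTime σ t : ℂ) =
      (Complex.exp (Complex.I * x * t) * Complex.exp (-((σ ^ 2 : ℝ) : ℂ) * (t : ℂ) ^ 2)) *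
        (√(σ * √(2 / Real.pi)) : ℝ) := fun t => by
    simp only [filterTime]; push_cast; ring_nf
  simp_rw [h0]
  rw [integral_mul_const, h]
  have h1 : ((Real.pi : ℂ) / ((σ ^ 2 : ℝ) : ℂ)) ^ (1 / 2 : ℂ) = ((√(Real.pi / σ ^ 2) : ℝ) : ℂ) := by
    rw [Real.sqrt_eq_rpow, Complex.ofReal_cpow (by positivity)]; push_cast; rfl
  have h2 : Complex.exp (-(x : ℂ) ^ 2 / (4 * ((σ ^ 2 : ℝ) : ℂ))) =
      ((Real.exp (-(x ^ 2 / (4 * σ ^ 2))) : ℝ) : ℂ) := by push_cast; ring_nf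
  rw [h1, h2]
  have h3 : √(Real.pi / σ ^ 2) * √(σ * √(2 / Real.pi)) =
      √(2 * Real.pi) / √(σ * √(2 * Real.pi)) := by
    have := integral_filterTime hσ
    unfold filterTime at this
    rw [integral_mul_const] at this
    have h : ∀ x : ℝ, -(σ ^ 2 * x ^ 2) = -(σ ^ 2) * x ^ 2 := fun x => by ring
    simp_rw [h, integral_gaussian] at this
    exact this
  rw [mul_right_comm, ← Complex.ofReal_mul, h3]
  unfold filterFreq
  push_cast
  ring

theorem metropolis_nonneg (β σ ω : ℝ) : 0 ≤ metropolis β σ ω := (Real.exp_pos _).le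

theorem metropolis_le_one {β : ℝ} (hβ : 0 < β) (σ ω : ℝ) : metropolis β σ ω ≤ 1 := by
  rw [metropolis, Real.exp_le_one_iff, neg_nonpos]
  exact mul_nonneg hβ.le (le_max_right _ _)

theorem continuous_metropolis (β σ : ℝ) : Continuous (metropolis β σ) := by
  unfold metropolis; fun_prop

/-- A bounded continuous weight times two shifted Gaussian filters is integrable. -/
theorem integrable_weight_mul_filterFreq {σ : ℝ} (hσ : 0 < σ) {w : ℝ → ℝ} (hw : Continuous w)
    (h0 : ∀ x, 0 ≤ w x) (h1 : ∀ x, w x ≤ 1) (ν₁ ν₂ : ℝ) :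
    Integrable fun ω => w ω * filterFreq σ (ω - ν₁) * filterFreq σ (ω - ν₂) := by
  refine ((integrable_filterFreq hσ).comp_sub_right ν₂).bdd_mul
    (c := 1 / √(σ * √(2 * Real.pi))) ?_ ?_
  · exact (hw.mul ((continuous_filterFreq σ).comp (by fun_prop))).aestronglyMeasurable
  · refine Filter.Eventually.of_forall fun x => ?_
    rw [Real.norm_of_nonneg (mul_nonneg (h0 x) (filterFreq_nonneg _ _))]
    exact (mul_le_of_le_one_left (filterFreq_nonneg _ _) (h1 x)).trans (filterFreq_le _ _)

/-- The symmetric part `h_{ν₁,ν₂}` of the transition coefficients. -/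
def symmCoeff (β σ ν₁ ν₂ : ℝ) : ℝ :=
  Real.exp (-(β ^ 2 * σ ^ 2 / 8)) *
    ∫ u : ℝ, Real.exp (-(β / 2 * |u|)) * filterFreq σ (u - ν₁) * filterFreq σ (u - ν₂)

theorem symmCoeff_comm (β σ ν₁ ν₂ : ℝ) : symmCoeff β σ ν₁ ν₂ = symmCoeff β σ ν₂ ν₁ := by
  unfold symmCoeff; simp_rw [mul_right_comm]

theorem symmCoeff_neg (β σ ν₁ ν₂ : ℝ) : symmCoeff β σ (-ν₁) (-ν₂) = symmCoeff β σ ν₁ ν₂ := by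
  unfold symmCoeff
  rw [← integral_neg_eq_self]
  congr 2
  ext u
  rw [abs_neg, ← filterFreq_neg σ (u - ν₁), ← filterFreq_neg σ (u - ν₂)]
  ring_nf

/-- Completing the square: a translation of the Gaussian is an exponential tilt. This is used for
detailed balance and again for the high-frequency decay. -/
theorem filterFreq_sub {σ : ℝ} (hσ : 0 < σ) (x a : ℝ) :
    filterFreq σ (x - 2 * σ ^ 2 * a) = filterFreq σ x * Real.exp (a * x - σ ^ 2 * a ^ 2) := by
  unfold filterFreq
  rw [mul_assoc (1 / √(σ * √(2 * Real.pi))), ← Real.exp_add]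
  congr 2
  field_simp
  ring

/-- Detailed balance at the level of coefficients. With `ω = u - βσ²/2` the Metropolis weight is
`e^{-βu/2} e^{-β|u|/2}`, and the tilts of the two shifted Gaussians cancel the odd factor
`e^{-βu/2}`. What remains besides the prefactor is symmetric in `ν₁, ν₂` and even. -/
theorem transitionCoeff_eq {σ : ℝ} (hσ : 0 < σ) (β ν₁ ν₂ : ℝ) :
    transitionCoeff β σ ν₁ ν₂ = Real.exp (-(β * (ν₁ + ν₂) / 4)) * symmCoeff β σ ν₁ ν₂ := by
  unfold transitionCoeff symmCoeff
  rw [← integral_sub_right_eq_self _ (β * σ ^ 2 / 2), ← mul_assoc, ← integral_const_mul]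
  congr 1
  ext u
  have h : ∀ ν, filterFreq σ (u - β * σ ^ 2 / 2 - ν) =
      filterFreq σ (u - ν) * Real.exp (β / 4 * (u - ν) - σ ^ 2 * (β / 4) ^ 2) := fun ν => by
    rw [← filterFreq_sub hσ]; congr 1; ring
  rw [h, h, metropolis, sub_add_cancel]
  have hm : max u 0 = (u + |u|) / 2 := by
    rcases le_total 0 u with hu | hu
    · rw [max_eq_left hu, abs_of_nonneg hu]; ring
    · rw [max_eq_right hu, abs_of_nonpos hu]; ring
  rw [hm]
  have : Real.exp (-(β * ((u + |u|) / 2))) * Real.exp (β / 4 * (u - ν₁) - σ ^ 2 * (β / 4) ^ 2) *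
      Real.exp (β / 4 * (u - ν₂) - σ ^ 2 * (β / 4) ^ 2) =
      Real.exp (-(β * (ν₁ + ν₂) / 4)) * Real.exp (-(β ^ 2 * σ ^ 2 / 8)) *
        Real.exp (-(β / 2 * |u|)) := by
    simp only [← Real.exp_add]; congr 1; ring
  linear_combination filterFreq σ (u - ν₁) * filterFreq σ (u - ν₂) * this

end Filters

/-! ### The Lindbladian as a double sum over Bohr frequencies. -/

section Lindbladian

variable {m : Type*} [Fintype m] [DecidableEq m] {H : Matrix m m ℂ} (hH : H.IsHermitian)

theorem opFT_eq_sum {σ : ℝ} (hσ : 0 < σ) (A : Matrix m m ℂ) (ω : ℝ) :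
    opFT H σ A ω = ∑ ν ∈ bohrFreqs hH, (filterFreq σ (ω - ν) : ℂ) • bohrComponent hH A ν := by
  unfold opFT
  have h1 : ∀ t : ℝ, (Complex.exp (-(Complex.I * ω * t)) * (filterTime σ t : ℂ)) • heisenberg H A t
      = ∑ ν ∈ bohrFreqs hH, (Complex.exp (Complex.I * (ν - ω : ℝ) * t) * (filterTime σ t : ℂ)) •
        bohrComponent hH A ν := fun t => by
    rw [heisenberg_eq_sum hH, Finset.smul_sum]
    refine Finset.sum_congr rfl fun ν _ => ?_
    rw [smul_smul, mul_right_comm, ← Complex.exp_add]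
    congr 3
    push_cast; ring
  have hint : ∀ x : ℝ, Integrable fun t : ℝ =>
      Complex.exp (Complex.I * x * t) * (filterTime σ t : ℂ) := fun x => by
    refine (integrable_filterTime hσ).ofReal.bdd_mul (c := 1) ?_ ?_
    · exact (by fun_prop : Continuous fun t : ℝ => Complex.exp (Complex.I * x * t)).aestronglyMeasurable
    · refine Filter.Eventually.of_forall fun t => ?_
      rw [mul_assoc, ← Complex.ofReal_mul, Complex.norm_exp_I_mul_ofReal]
  simp_rw [h1]
  rw [integral_finsetSum _ fun ν _ => (hint _).smul_const _, Finset.smul_sum]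
  refine Finset.sum_congr rfl fun ν _ => ?_
  rw [integral_smul_const, integral_cexp_mul_filterTime hσ, smul_smul, ← neg_sub, filterFreq_neg,
    ← mul_assoc, ← Complex.ofReal_mul, one_div, inv_mul_cancel₀ (by positivity), Complex.ofReal_one,
    one_mul]

theorem lindbladian_eq_sum {β σ : ℝ} (hβ : 0 < β) (hσ : 0 < σ) (A X : Matrix m m ℂ) :
    lindbladian hH β σ A X =
      -Complex.I • (coherentTerm hH β σ A * X - X * coherentTerm hH β σ A) +
      ∑ ν₁ ∈ bohrFreqs hH, ∑ ν₂ ∈ bohrFreqs hH, (transitionCoeff β σ ν₁ ν₂ : ℂ) •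
        (bohrComponent hH A ν₁ * X * (bohrComponent hH A ν₂).conjTranspose -
          (1 / 2 : ℂ) • ((bohrComponent hH A ν₂).conjTranspose * bohrComponent hH A ν₁ * X +
            X * ((bohrComponent hH A ν₂).conjTranspose * bohrComponent hH A ν₁))) := by
  unfold lindbladian
  congr 1
  have h1 : ∀ ω : ℝ, (metropolis β σ ω : ℂ) •
      (opFT H σ A ω * X * (opFT H σ A ω).conjTranspose -
        (1 / 2 : ℂ) • ((opFT H σ A ω).conjTranspose * opFT H σ A ω * X +
          X * ((opFT H σ A ω).conjTranspose * opFT H σ A ω))) =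
      ∑ ν₁ ∈ bohrFreqs hH, ∑ ν₂ ∈ bohrFreqs hH,
        ((metropolis β σ ω * filterFreq σ (ω - ν₁) * filterFreq σ (ω - ν₂) : ℝ) : ℂ) •
        (bohrComponent hH A ν₁ * X * (bohrComponent hH A ν₂).conjTranspose -
          (1 / 2 : ℂ) • ((bohrComponent hH A ν₂).conjTranspose * bohrComponent hH A ν₁ * X +
            X * ((bohrComponent hH A ν₂).conjTranspose * bohrComponent hH A ν₁))) := fun ω => by
    have hd : (opFT H σ A ω).conjTranspose = ∑ ν ∈ bohrFreqs hH,
        (filterFreq σ (ω - ν) : ℂ) • (bohrComponent hH A ν).conjTranspose := by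
      rw [opFT_eq_sum hH hσ, Matrix.conjTranspose_sum]
      simp [Matrix.conjTranspose_smul]
    have h2 : (opFT H σ A ω).conjTranspose * opFT H σ A ω =
        ∑ ν₁ ∈ bohrFreqs hH, ∑ ν₂ ∈ bohrFreqs hH,
          ((filterFreq σ (ω - ν₁) * filterFreq σ (ω - ν₂) : ℝ) : ℂ) •
          ((bohrComponent hH A ν₂).conjTranspose * bohrComponent hH A ν₁) := by
      rw [hd, opFT_eq_sum hH hσ]
      simp only [Finset.mul_sum, Finset.sum_mul, Matrix.smul_mul, Matrix.mul_smul, smul_smul,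
        Complex.ofReal_mul]
    have h3 : opFT H σ A ω * X * (opFT H σ A ω).conjTranspose =
        ∑ ν₁ ∈ bohrFreqs hH, ∑ ν₂ ∈ bohrFreqs hH,
          ((filterFreq σ (ω - ν₁) * filterFreq σ (ω - ν₂) : ℝ) : ℂ) •
          (bohrComponent hH A ν₁ * X * (bohrComponent hH A ν₂).conjTranspose) := by
      rw [hd, opFT_eq_sum hH hσ, Finset.sum_mul, Finset.sum_mul]
      simp only [Finset.mul_sum, Matrix.smul_mul, Matrix.mul_smul, smul_smul, Complex.ofReal_mul,
        mul_comm]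
    rw [h2, h3]
    simp only [mul_assoc (metropolis β σ ω), Complex.ofReal_mul (metropolis β σ ω), mul_smul,
      ← Finset.smul_sum, smul_sub, smul_add, Finset.sum_sub_distrib, Finset.sum_add_distrib,
      Finset.sum_mul, Finset.mul_sum, Matrix.smul_mul, Matrix.mul_smul,
      smul_comm _ (1 / 2 : ℂ)]
  simp_rw [h1]
  have hint := integrable_weight_mul_filterFreq hσ (continuous_metropolis β σ)
    (metropolis_nonneg β σ) (metropolis_le_one hβ σ)
  have hc : ∀ ν₁ ν₂, Integrable fun ω => ((metropolis β σ ω * filterFreq σ (ω - ν₁) *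
      filterFreq σ (ω - ν₂) : ℝ) : ℂ) := fun ν₁ ν₂ => (hint ν₁ ν₂).ofReal
  rw [integral_finsetSum _ fun ν₁ _ => integrable_finsetSum _ fun ν₂ _ =>
    (hc ν₁ ν₂).smul_const _]
  refine Finset.sum_congr rfl fun ν₁ _ => ?_
  rw [integral_finsetSum (bohrFreqs hH) fun ν₂ _ => (hc ν₁ ν₂).smul_const _]
  refine Finset.sum_congr rfl fun ν₂ _ => ?_
  rw [integral_smul_const, transitionCoeff]
  congr 1
  exact integral_ofReal

end Lindbladian

/-! ### The Dirichlet form as a quadratic form in commutators. -/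

section Dirichlet

variable {m : Type*} [Fintype m] [DecidableEq m] {H : Matrix m m ℂ} (hH : H.IsHermitian)

/-- The factor `1/(2i)` in the coherent term makes `-i[B, ·]` a real combination that tilts the
anticommutator's weights `½, ½` to `(1 ∓ tanh)/2`. -/
theorem lindbladian_eq_sum_real {β σ : ℝ} (hβ : 0 < β) (hσ : 0 < σ) (A X : Matrix m m ℂ) :
    lindbladian hH β σ A X =
      ∑ ν₁ ∈ bohrFreqs hH, ∑ ν₂ ∈ bohrFreqs hH, (transitionCoeff β σ ν₁ ν₂ : ℂ) •
        (bohrComponent hH A ν₁ * X * (bohrComponent hH A ν₂).conjTranspose -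
          (((1 - Real.tanh (β * (ν₁ - ν₂) / 4)) / 2 : ℝ) : ℂ) •
            ((bohrComponent hH A ν₂).conjTranspose * bohrComponent hH A ν₁ * X) -
          (((1 + Real.tanh (β * (ν₁ - ν₂) / 4)) / 2 : ℝ) : ℂ) •
            (X * ((bohrComponent hH A ν₂).conjTranspose * bohrComponent hH A ν₁))) := by
  rw [lindbladian_eq_sum hH hβ hσ, coherentTerm]
  simp only [Finset.sum_mul, Finset.mul_sum, ← Finset.sum_sub_distrib, Finset.smul_sum,
    ← Finset.sum_add_distrib, Matrix.smul_mul, Matrix.mul_smul]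
  refine Finset.sum_congr rfl fun ν₁ _ => Finset.sum_congr rfl fun ν₂ _ => ?_
  rw [Real.tanh_neg]
  push_cast
  generalize (transitionCoeff β σ ν₁ ν₂ : ℂ) = a
  generalize Complex.tanh _ = th
  generalize bohrComponent hH A ν₁ * X * (bohrComponent hH A ν₂).conjTranspose = P
  generalize (bohrComponent hH A ν₂).conjTranspose * bohrComponent hH A ν₁ = Q
  have h : -Complex.I * (-th * a / (2 * Complex.I)) = th * a / 2 := by
    field_simp
  rw [← smul_sub, smul_smul, h]
  module

theorem sum_neg_bohrFreqs {M : Type*} [AddCommMonoid M] (f : ℝ → M) :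
    ∑ ν ∈ bohrFreqs hH, f (-ν) = ∑ ν ∈ bohrFreqs hH, f ν :=
  Finset.sum_nbij' (fun x => -x) (fun x => -x) (fun _ h => neg_mem_bohrFreqs hH h)
    (fun _ h => neg_mem_bohrFreqs hH h) (by simp) (by simp) (by simp)

variable {s : Matrix m m ℂ} {β σ : ℝ} (A O : Matrix m m ℂ)

theorem neg_kmsInner_hsAdjoint_eq_sum (hβ : 0 < β) (hσ : 0 < σ) {ρ : Matrix m m ℂ}
    (hsq : CFC.sqrt ρ = s) (hs : s.IsHermitian) :
    -kmsInner ρ O (hsAdjoint (lindbladian hH β σ A) O) =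
      ∑ ν₁ ∈ bohrFreqs hH, ∑ ν₂ ∈ bohrFreqs hH, (transitionCoeff β σ ν₁ ν₂ : ℂ) *
        (-(bohrComponent hH A ν₂ * (s * O.conjTranspose * s) *
            (bohrComponent hH A ν₁).conjTranspose * O).trace +
          (((1 - Real.tanh (β * (ν₁ - ν₂) / 4)) / 2 : ℝ) : ℂ) *
            ((s * O.conjTranspose * s) * (bohrComponent hH A ν₁).conjTranspose *
              bohrComponent hH A ν₂ * O).trace +
          (((1 + Real.tanh (β * (ν₁ - ν₂) / 4)) / 2 : ℝ) : ℂ) *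
            ((bohrComponent hH A ν₁).conjTranspose * bohrComponent hH A ν₂ *
              (s * O.conjTranspose * s) * O).trace) := by
  -- `hsAdjoint` accepts any function; its adjoint identity needs linearity, which is read off the
  -- finite sum.
  have hlin : IsLinearMap ℂ (lindbladian hH β σ A) := by
    constructor
    · intro X Y
      simp only [lindbladian_eq_sum_real hH hβ hσ, mul_add, add_mul, smul_add, ← Finset.sum_add_distrib]
      refine Finset.sum_congr rfl fun ν₁ _ => Finset.sum_congr rfl fun ν₂ _ => ?_
      module
    · intro c X
      simp only [lindbladian_eq_sum_real hH hβ hσ, Finset.smul_sum, Matrix.smul_mul,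
        Matrix.mul_smul]
      refine Finset.sum_congr rfl fun ν₁ _ => Finset.sum_congr rfl fun ν₂ _ => ?_
      module
  have h1 : kmsInner ρ O (hsAdjoint (lindbladian hH β σ A) O) =
      ((lindbladian hH β σ A (s * O * s)).conjTranspose * O).trace := by
    rw [← hlin.mk'_apply, ← trace_hsAdjoint, kmsInner, hsq, Matrix.trace_mul_comm]
    simp only [Matrix.conjTranspose_mul, hs.eq, mul_assoc]
    rfl
  rw [h1, lindbladian_eq_sum_real hH hβ hσ, Matrix.conjTranspose_sum, Finset.sum_mul,
    Matrix.trace_sum, ← Finset.sum_neg_distrib]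
  refine Finset.sum_congr rfl fun ν₁ _ => ?_
  rw [Matrix.conjTranspose_sum, Finset.sum_mul, Matrix.trace_sum, ← Finset.sum_neg_distrib]
  refine Finset.sum_congr rfl fun ν₂ _ => ?_
  simp only [Matrix.conjTranspose_smul, Matrix.conjTranspose_sub, Matrix.conjTranspose_mul,
    Matrix.conjTranspose_conjTranspose, hs.eq, Complex.star_def, Complex.conj_ofReal,
    Matrix.smul_mul, Matrix.trace_smul, sub_mul, Matrix.trace_sub, smul_eq_mul, mul_assoc]
  ring

/-- With `s = ρ^{1/2}`, moving `s` past a Bohr component costs only a scalar `e^{±βν₁/2}`. This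
brings the four terms of the KMS product to the traces that occur in the Dirichlet form. -/
theorem trace_commutator_bohrComponent (hA : A.IsHermitian)
    (hs : ∀ ν, s * bohrComponent hH A ν =
      (Real.exp (-(β * ν / 2)) : ℂ) • (bohrComponent hH A ν * s)) (ν₁ ν₂ : ℝ) :
    ((bohrComponent hH A ν₁ * O - O * bohrComponent hH A ν₁).conjTranspose * s *
        (bohrComponent hH A ν₂ * O - O * bohrComponent hH A ν₂) * s).trace =
      (Real.exp (-(β * ν₁ / 2)) : ℂ) * ((s * O.conjTranspose * s) *
        (bohrComponent hH A ν₁).conjTranspose * bohrComponent hH A ν₂ * O).trace -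
      (Real.exp (-(β * ν₁ / 2)) : ℂ) * (bohrComponent hH A ν₂ * (s * O.conjTranspose * s) *
            (bohrComponent hH A ν₁).conjTranspose * O).trace +
      (Real.exp (β * ν₁ / 2) : ℂ) * (((bohrComponent hH A (-ν₂)).conjTranspose *
        bohrComponent hH A (-ν₁) * (s * O.conjTranspose * s) * O).trace -
        (bohrComponent hH A (-ν₁) * (s * O.conjTranspose * s) *
            (bohrComponent hH A (-ν₂)).conjTranspose * O).trace) := by
  have hd : ∀ ν, (bohrComponent hH A ν).conjTranspose = bohrComponent hH A (-ν) := fun ν => by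
    rw [conjTranspose_bohrComponent, hA.eq]
  have h2 : ∀ ν, bohrComponent hH A ν * s =
      (Real.exp (β * ν / 2) : ℂ) • (s * bohrComponent hH A ν) := fun ν => by
    rw [hs, smul_smul, ← Complex.ofReal_mul, ← Real.exp_add]; simp
  simp only [Matrix.conjTranspose_sub, Matrix.conjTranspose_mul, hd, neg_neg]
  generalize O.conjTranspose = P
  generalize hB : bohrComponent hH A ν₂ = B
  have e1 : bohrComponent hH A (-ν₁) * s =
      (Real.exp (-(β * ν₁ / 2)) : ℂ) • (s * bohrComponent hH A (-ν₁)) := by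
    rw [h2]; congr 4; ring
  have e2 : s * bohrComponent hH A (-ν₁) =
      (Real.exp (β * ν₁ / 2) : ℂ) • (bohrComponent hH A (-ν₁) * s) := by
    rw [hs]; congr 4; ring
  generalize bohrComponent hH A (-ν₁) = D at e1 e2
  generalize (Real.exp (-(β * ν₁ / 2)) : ℂ) = x at *
  generalize (Real.exp (β * ν₁ / 2) : ℂ) = y at *
  have t1 : (P * D * s * (B * O) * s).trace = x * (s * P * s * D * B * O).trace := by
    rw [Matrix.trace_mul_comm]
    calc (s * (P * D * s * (B * O))).trace = (s * P * (D * s) * B * O).trace := by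
          simp only [mul_assoc]
      _ = _ := by
          rw [e1]; simp only [Matrix.mul_smul, Matrix.smul_mul, Matrix.trace_smul, smul_eq_mul, mul_assoc]
  have t2 : (P * D * s * (O * B) * s).trace = x * (B * (s * P * s) * D * O).trace := by
    calc (P * D * s * (O * B) * s).trace = (P * (D * s) * (O * B * s)).trace := by
          simp only [mul_assoc]
      _ = x * ((P * s * D * O) * (B * s)).trace := by
          rw [e1]; simp only [Matrix.mul_smul, Matrix.smul_mul, Matrix.trace_smul, smul_eq_mul, mul_assoc]
      _ = _ := by rw [Matrix.trace_mul_comm]; simp only [mul_assoc]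
  have t3 : (D * P * s * (B * O) * s).trace = y * (D * (s * P * s) * B * O).trace := by
    rw [Matrix.trace_mul_comm]
    calc (s * (D * P * s * (B * O))).trace = ((s * D) * P * s * B * O).trace := by
          simp only [mul_assoc]
      _ = _ := by
          rw [e2]; simp only [Matrix.smul_mul, Matrix.trace_smul, smul_eq_mul, mul_assoc]
  have t4 : (D * P * s * (O * B) * s).trace = y * (B * D * (s * P * s) * O).trace := by
    calc (D * P * s * (O * B) * s).trace = ((D * P * s * O) * (B * s)).trace := by
          simp only [mul_assoc]
      _ = ((B * (s * D) * P * s * O)).trace := by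
          rw [Matrix.trace_mul_comm]; simp only [mul_assoc]
      _ = _ := by
          rw [e2]; simp only [Matrix.mul_smul, Matrix.smul_mul, Matrix.trace_smul, smul_eq_mul, mul_assoc]
  simp only [sub_mul, mul_sub, Matrix.trace_sub, t1, t2, t3, t4]
  ring

/-- The weights of the Dirichlet form in the Bohr decomposition. -/
def dirichletWeight (β σ ν₁ ν₂ : ℝ) : ℝ :=
  symmCoeff β σ ν₁ ν₂ * (1 / (2 * Real.cosh (β * (ν₁ - ν₂) / 4)))

theorem neg_kmsInner_hsAdjoint_eq_sum_commutator (hβ : 0 < β) (hσ : 0 < σ) (hA : A.IsHermitian)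
    {ρ : Matrix m m ℂ} (hsq : CFC.sqrt ρ = s) (hs : s.IsHermitian)
    (hsA : ∀ ν, s * bohrComponent hH A ν =
      (Real.exp (-(β * ν / 2)) : ℂ) • (bohrComponent hH A ν * s)) :
    -kmsInner ρ O (hsAdjoint (lindbladian hH β σ A) O) =
      ∑ ν₁ ∈ bohrFreqs hH, ∑ ν₂ ∈ bohrFreqs hH, (dirichletWeight β σ ν₁ ν₂ : ℂ) *
        kmsInner ρ (bohrComponent hH A ν₁ * O - O * bohrComponent hH A ν₁)
          (bohrComponent hH A ν₂ * O - O * bohrComponent hH A ν₂) := by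
  rw [neg_kmsInner_hsAdjoint_eq_sum hH A O hβ hσ hsq hs]
  simp only [kmsInner, hsq, trace_commutator_bohrComponent hH A O hA hsA]
  simp only [mul_add _ _ ((Real.exp _ : ℂ) * (_ - _)), Finset.sum_add_distrib]
  -- The substitution `(ν₁, ν₂) ↦ (-ν₂, -ν₁)` preserves the weight, since `symmCoeff` is symmetric
  -- and even and `ν₁ - ν₂` is unchanged. It brings the second pair of terms to the form of the
  -- first.
  have hswap : ∀ f : ℝ → ℝ → ℂ, ∑ ν₁ ∈ bohrFreqs hH, ∑ ν₂ ∈ bohrFreqs hH,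
      (dirichletWeight β σ ν₁ ν₂ : ℂ) * ((Real.exp (β * ν₁ / 2) : ℂ) * f (-ν₂) (-ν₁)) =
      ∑ ν₁ ∈ bohrFreqs hH, ∑ ν₂ ∈ bohrFreqs hH,
      (dirichletWeight β σ ν₁ ν₂ : ℂ) * ((Real.exp (-(β * ν₂ / 2)) : ℂ) * f ν₁ ν₂) := fun f => by
    rw [Finset.sum_comm, ← sum_neg_bohrFreqs]
    refine Finset.sum_congr rfl fun ν₁ _ => ?_
    rw [← sum_neg_bohrFreqs]
    refine Finset.sum_congr rfl fun ν₂ _ => ?_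
    rw [neg_neg, neg_neg]
    congr 2
    · rw [dirichletWeight, dirichletWeight, symmCoeff_neg, symmCoeff_comm]; congr 6; ring
    · congr 2; ring
  rw [hswap fun ν₁ ν₂ => ((bohrComponent hH A ν₁).conjTranspose *
        bohrComponent hH A ν₂ * (s * O.conjTranspose * s) * O).trace -
        (bohrComponent hH A ν₂ * (s * O.conjTranspose * s) *
            (bohrComponent hH A ν₁).conjTranspose * O).trace]
  simp only [← Finset.sum_add_distrib]
  refine Finset.sum_congr rfl fun ν₁ _ => Finset.sum_congr rfl fun ν₂ _ => ?_
  have hc := (Real.cosh_pos (β * (ν₁ - ν₂) / 4)).ne'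
  -- This is where the choice of `tanh` in the coherent term pays off: `(1 ∓ tanh x)/2 = e^{∓x}/(2
  -- cosh x)`, and `e^{∓x}` with `x = β(ν₁-ν₂)/4` completes the prefactor of `transitionCoeff` to
  -- `e^{-βν₁/2}` or `e^{-βν₂/2}`.
  have k1 : transitionCoeff β σ ν₁ ν₂ * ((1 - Real.tanh (β * (ν₁ - ν₂) / 4)) / 2) =
      dirichletWeight β σ ν₁ ν₂ * Real.exp (-(β * ν₁ / 2)) := by
    rw [transitionCoeff_eq hσ, dirichletWeight, Real.tanh_eq_sinh_div_cosh]
    have : Real.exp (-(β * (ν₁ + ν₂) / 4)) * Real.exp (-(β * (ν₁ - ν₂) / 4)) =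
      Real.exp (-(β * ν₁ / 2)) := by rw [← Real.exp_add]; ring_nf
    rw [← this, ← Real.cosh_sub_sinh (β * (ν₁ - ν₂) / 4)]
    field_simp
  have k2 : transitionCoeff β σ ν₁ ν₂ * ((1 + Real.tanh (β * (ν₁ - ν₂) / 4)) / 2) =
      dirichletWeight β σ ν₁ ν₂ * Real.exp (-(β * ν₂ / 2)) := by
    rw [transitionCoeff_eq hσ, dirichletWeight, Real.tanh_eq_sinh_div_cosh]
    have : Real.exp (-(β * (ν₁ + ν₂) / 4)) * Real.exp (β * (ν₁ - ν₂) / 4) =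
      Real.exp (-(β * ν₂ / 2)) := by rw [← Real.exp_add]; ring_nf
    rw [← this, ← Real.cosh_add_sinh (β * (ν₁ - ν₂) / 4)]
    field_simp
  have k3 : transitionCoeff β σ ν₁ ν₂ =
      dirichletWeight β σ ν₁ ν₂ * (Real.exp (-(β * ν₁ / 2)) + Real.exp (-(β * ν₂ / 2))) := by
    rw [mul_add, ← k1, ← k2]; ring
  have k1' := congrArg (fun x : ℝ => (x : ℂ)) k1
  have k2' := congrArg (fun x : ℝ => (x : ℂ)) k2
  have k3' := congrArg (fun x : ℝ => (x : ℂ)) k3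
  simp only [Complex.ofReal_mul, Complex.ofReal_add _ (Real.exp _)] at k1' k2' k3'
  generalize (bohrComponent hH A ν₂ * (s * O.conjTranspose * s) *
    (bohrComponent hH A ν₁).conjTranspose * O).trace = a
  generalize ((s * O.conjTranspose * s) * (bohrComponent hH A ν₁).conjTranspose *
    bohrComponent hH A ν₂ * O).trace = b
  generalize ((bohrComponent hH A ν₁).conjTranspose * bohrComponent hH A ν₂ *
    (s * O.conjTranspose * s) * O).trace = c
  linear_combination -a * k3' + b * k1' + c * k2'

end Dirichlet

/-! ### Gibbs states and the KMS norm. -/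

section Gibbs

variable {m : Type*} [Fintype m] [DecidableEq m] {H : Matrix m m ℂ}

theorem isHermitian_exp_ofReal_smul (hH : H.IsHermitian) (r : ℝ) : (exp ((r : ℂ) • H)).IsHermitian := by
  refine Matrix.IsHermitian.exp ?_
  rw [Matrix.IsHermitian, Matrix.conjTranspose_smul, hH.eq]
  simp

theorem exp_smul_mul_exp_neg_smul (H : Matrix m m ℂ) (z : ℂ) : exp (z • H) * exp (-z • H) = 1 := by
  rw [exp_smul_mul_exp_smul]; simp

/-- The partition function `Tr e^{-βH}`. -/
def partitionFn (H : Matrix m m ℂ) (β : ℝ) : ℝ := (exp (-(β : ℂ) • H)).trace.re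

theorem trace_exp_pos [Nonempty m] (hH : H.IsHermitian) (β : ℝ) : 0 < (exp (-(β : ℂ) • H)).trace := by
  have h1 : exp (-(β : ℂ) • H) = (exp (((-β / 2 : ℝ) : ℂ) • H)).conjTranspose * exp (((-β / 2 : ℝ) : ℂ) • H) := by
    rw [(isHermitian_exp_ofReal_smul hH _).eq, exp_smul_mul_exp_smul]
    congr 2
    push_cast; ring
  rw [h1]
  refine lt_of_le_of_ne (Matrix.posSemidef_conjTranspose_mul_self _).trace_nonneg fun h => ?_
  have h2 := Matrix.trace_conjTranspose_mul_self_eq_zero_iff.1 h.symm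
  have h3 := exp_smul_mul_exp_neg_smul H (((-β / 2 : ℝ) : ℂ))
  rw [h2, zero_mul] at h3
  exact zero_ne_one h3

theorem trace_exp_eq_partitionFn [Nonempty m] (hH : H.IsHermitian) (β : ℝ) :
    (exp (-(β : ℂ) • H)).trace = partitionFn H β := by
  have := (Complex.lt_def.1 (trace_exp_pos hH β)).2
  apply Complex.ext
  · simp [partitionFn]
  · simpa using this.symm

theorem partitionFn_pos [Nonempty m] (hH : H.IsHermitian) (β : ℝ) : 0 < partitionFn H β :=
  (Complex.lt_def.1 (trace_exp_pos hH β)).1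

/-- The fourth root of the Gibbs state. -/
def gibbsRoot (H : Matrix m m ℂ) (β : ℝ) : Matrix m m ℂ :=
  ((partitionFn H β ^ (-(1 / 4) : ℝ) : ℝ) : ℂ) • exp (((-(β / 4) : ℝ) : ℂ) • H)

theorem isHermitian_gibbsRoot (hH : H.IsHermitian) (β : ℝ) : (gibbsRoot H β).IsHermitian := by
  rw [Matrix.IsHermitian, gibbsRoot, Matrix.conjTranspose_smul, (isHermitian_exp_ofReal_smul hH _).eq]
  simp

/-- The square root of the Gibbs state. -/
def gibbsSqrt (H : Matrix m m ℂ) (β : ℝ) : Matrix m m ℂ := gibbsRoot H β * gibbsRoot H β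

theorem isHermitian_gibbsSqrt (hH : H.IsHermitian) (β : ℝ) : (gibbsSqrt H β).IsHermitian := by
  rw [Matrix.IsHermitian, gibbsSqrt, Matrix.conjTranspose_mul, (isHermitian_gibbsRoot hH β).eq]

theorem gibbsSqrt_mul_self [Nonempty m] (hH : H.IsHermitian) (β : ℝ) :
    gibbsSqrt H β * gibbsSqrt H β = gibbs H β := by
  have hZ := partitionFn_pos hH β
  rw [gibbs, trace_exp_eq_partitionFn hH]
  simp only [gibbsSqrt, gibbsRoot, Matrix.smul_mul, Matrix.mul_smul, smul_smul, exp_smul_mul_exp_smul]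
  congr 1
  · rw [← Complex.ofReal_inv, ← Real.rpow_neg_one]
    simp only [← Complex.ofReal_mul, ← Real.rpow_add hZ]
    norm_num
  · congr 2; push_cast; ring

theorem sqrt_gibbs [Nonempty m] (hH : H.IsHermitian) (β : ℝ) :
    CFC.sqrt (gibbs H β) = gibbsSqrt H β := by
  refine CFC.sqrt_unique (gibbsSqrt_mul_self hH β) ?_
  rw [Matrix.nonneg_iff_posSemidef, gibbsSqrt]
  nth_rewrite 1 [← (isHermitian_gibbsRoot hH β).eq]
  exact Matrix.posSemidef_conjTranspose_mul_self _

theorem trace_gibbs [Nonempty m] (hH : H.IsHermitian) (β : ℝ) : (gibbs H β).trace = 1 := by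
  rw [gibbs, Matrix.trace_smul, smul_eq_mul, inv_mul_cancel₀ (trace_exp_pos hH β).ne']

theorem gibbsSqrt_mul_bohrComponent (hH : H.IsHermitian) (β : ℝ) (A : Matrix m m ℂ) (ν : ℝ) :
    gibbsSqrt H β * bohrComponent hH A ν =
      (Real.exp (-(β * ν / 2)) : ℂ) • (bohrComponent hH A ν * gibbsSqrt H β) := by
  have h : gibbsSqrt H β = ((partitionFn H β ^ (-(1 / 4) : ℝ) : ℝ) *
      (partitionFn H β ^ (-(1 / 4) : ℝ) : ℝ) : ℂ) • exp ((-(β / 2) : ℂ) • H) := by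
    simp only [gibbsSqrt, gibbsRoot, Matrix.smul_mul, Matrix.mul_smul, exp_smul_mul_exp_smul,
      smul_smul]
    congr 3; push_cast; ring
  rw [h, Matrix.smul_mul, Matrix.mul_smul, exp_mul_bohrComponent, smul_comm]
  congr 1
  push_cast
  congr 1
  ring

theorem gibbs_conj [Nonempty m] (hH : H.IsHermitian) (β : ℝ) (A : Matrix m m ℂ) :
    gibbs H β * A * (gibbs H β)⁻¹ =
      ∑ ν ∈ bohrFreqs hH, Complex.exp (-(β : ℂ) * ν) • bohrComponent hH A ν := by
  have hZ := (trace_exp_pos hH β).ne'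
  have hinv : (gibbs H β)⁻¹ = (exp (-(β : ℂ) • H)).trace • exp (-(-(β : ℂ)) • H) := by
    refine Matrix.inv_eq_right_inv ?_
    rw [gibbs, Matrix.smul_mul, Matrix.mul_smul, smul_smul, inv_mul_cancel₀ hZ, one_smul,
      exp_smul_mul_exp_neg_smul]
  rw [hinv, ← exp_conj_eq_sum, gibbs]
  simp only [Matrix.smul_mul, Matrix.mul_smul, smul_smul, mul_inv_cancel₀ hZ, one_smul]

theorem gibbs_conj_inv [Nonempty m] (hH : H.IsHermitian) (β : ℝ) (A : Matrix m m ℂ) :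
    (gibbs H β)⁻¹ * A * gibbs H β =
      ∑ ν ∈ bohrFreqs hH, Complex.exp ((β : ℂ) * ν) • bohrComponent hH A ν := by
  have hZ := (trace_exp_pos hH β).ne'
  have hinv : (gibbs H β)⁻¹ = (exp (-(β : ℂ) • H)).trace • exp ((β : ℂ) • H) := by
    refine Matrix.inv_eq_right_inv ?_
    rw [gibbs, Matrix.smul_mul, Matrix.mul_smul, smul_smul, inv_mul_cancel₀ hZ, one_smul,
      exp_smul_mul_exp_smul]
    simp
  rw [hinv, ← exp_conj_eq_sum, gibbs]
  simp only [Matrix.smul_mul, Matrix.mul_smul, smul_smul, inv_mul_cancel₀ hZ, one_smul]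

theorem isUnit_gibbs [Nonempty m] (hH : H.IsHermitian) (β : ℝ) : IsUnit (gibbs H β) := by
  have hZ := (trace_exp_pos hH β).ne'
  exact (Matrix.isUnit_exp _).smul (Units.mk0 _ (inv_ne_zero hZ))

/-- The norm of a Hermitian matrix is its spectral radius, which is invariant under similarity and
never exceeds the norm. It yields the a priori bound by the conjugated norms. -/
theorem norm_le_norm_conj {A : Matrix m m ℂ} (hA : A.IsHermitian) {g : Matrix m m ℂ} (hg : IsUnit g) :
    ‖A‖ ≤ ‖g * A * g⁻¹‖ := by
  cases isEmpty_or_nonempty m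
  · rw [Subsingleton.elim (g * A * g⁻¹) A]
  obtain ⟨u, rfl⟩ := hg
  have h1 : spectralRadius ℂ A = ‖A‖₊ := IsSelfAdjoint.spectralRadius_eq_nnnorm hA
  have h2 : spectralRadius ℂ ((u : Matrix m m ℂ) * A * (u : Matrix m m ℂ)⁻¹) = spectralRadius ℂ A := by
    unfold spectralRadius
    rw [← Matrix.coe_units_inv, spectrum.units_conjugate]
  have h3 := spectrum.spectralRadius_le_nnnorm (𝕜 := ℂ) ((u : Matrix m m ℂ) * A * (u : Matrix m m ℂ)⁻¹)
  rw [h2, h1] at h3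
  exact_mod_cast h3

/-- The isometric embedding of operators with the KMS norm into a Euclidean space. -/
def kmsEmbed (H : Matrix m m ℂ) (β : ℝ) : Matrix m m ℂ →ₗ[ℂ] EuclideanSpace ℂ (m × m) where
  toFun X := WithLp.toLp 2 fun p => (gibbsRoot H β * X * gibbsRoot H β) p.1 p.2
  map_add' X Y := by ext p; simp [mul_add, add_mul]
  map_smul' c X := by ext p; simp

theorem inner_kmsEmbed [Nonempty m] (hH : H.IsHermitian) (β : ℝ) (X Y : Matrix m m ℂ) :
    inner ℂ (kmsEmbed H β X) (kmsEmbed H β Y) = kmsInner (gibbs H β) X Y := by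
  have h : kmsInner (gibbs H β) X Y = ((gibbsRoot H β * X * gibbsRoot H β).conjTranspose *
      (gibbsRoot H β * Y * gibbsRoot H β)).trace := by
    rw [kmsInner, sqrt_gibbs hH]
    simp only [Matrix.conjTranspose_mul, (isHermitian_gibbsRoot hH β).eq, gibbsSqrt]
    rw [← mul_assoc _ (gibbsRoot H β) (gibbsRoot H β), Matrix.trace_mul_comm]
    simp only [mul_assoc]
  rw [h, PiLp.inner_apply, Fintype.sum_prod_type]
  simp only [Matrix.trace, Matrix.diag, Matrix.mul_apply (M := Matrix.conjTranspose _),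
    Matrix.conjTranspose_apply]
  rw [Finset.sum_comm]
  refine Finset.sum_congr rfl fun i _ => Finset.sum_congr rfl fun j _ => ?_
  simp [kmsEmbed, mul_comm]

theorem norm_kmsEmbed [Nonempty m] (hH : H.IsHermitian) (β : ℝ) (X : Matrix m m ℂ) :
    ‖kmsEmbed H β X‖ = kmsNorm (gibbs H β) X := by
  rw [kmsNorm, ← inner_kmsEmbed hH, norm_eq_sqrt_re_inner (𝕜 := ℂ)]
  rfl

theorem trace_mul_conjTranspose_mul_le (X s : Matrix m m ℂ) :
    (s.conjTranspose * (X.conjTranspose * X) * s).trace.re ≤ ‖X‖ ^ 2 * (s.conjTranspose * s).trace.re := by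
  have h1 : X.conjTranspose * X ≤ algebraMap ℝ (Matrix m m ℂ) (‖X‖ ^ 2) :=
    CStarAlgebra.star_mul_le_algebraMap_norm_sq
  have h2 := ((Matrix.le_iff.1 h1).conjTranspose_mul_mul_same s).trace_nonneg
  have h3 := (Complex.le_def.1 h2).1
  rw [mul_sub, sub_mul, Matrix.trace_sub, Complex.sub_re, Complex.zero_re, sub_nonneg] at h3
  refine h3.trans_eq ?_
  rw [Algebra.algebraMap_eq_smul_one, Matrix.mul_smul, mul_one, Matrix.smul_mul, Matrix.trace_smul,
    Complex.smul_re, smul_eq_mul]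

/-- With `s = ρ^{1/2}`, expanding `Tr |sX - Xs|² ≥ 0` gives `2 Tr[X†sXs] ≤ Tr[s XX† s] + Tr[s X†X
s]`, and each term on the right is at most `‖X‖² Tr ρ = ‖X‖²`. -/
theorem norm_kmsEmbed_le [Nonempty m] (hH : H.IsHermitian) (β : ℝ) (X : Matrix m m ℂ) :
    ‖kmsEmbed H β X‖ ≤ ‖X‖ := by
  set s := gibbsSqrt H β with hs
  have hsH : s.conjTranspose = s := (isHermitian_gibbsSqrt hH β).eq
  have htr : (s * s).trace = 1 := by rw [hs, gibbsSqrt_mul_self hH, trace_gibbs hH]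
  have h0 : ‖kmsEmbed H β X‖ ^ 2 = (X.conjTranspose * s * X * s).trace.re := by
    rw [← inner_self_eq_norm_sq (𝕜 := ℂ), inner_kmsEmbed hH, kmsInner, sqrt_gibbs hH]; rfl
  have h1 := (Complex.le_def.1 (Matrix.posSemidef_conjTranspose_mul_self (s * X - X * s)).trace_nonneg).1
  have h2 := trace_mul_conjTranspose_mul_le X s
  have h3 := trace_mul_conjTranspose_mul_le X.conjTranspose s
  rw [Matrix.l2_opNorm_conjTranspose, Matrix.conjTranspose_conjTranspose] at h3
  rw [hsH, htr] at h2 h3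
  have e1 : (X.conjTranspose * s * (s * X)).trace = (s * (X * X.conjTranspose) * s).trace := by
    rw [Matrix.trace_mul_comm]; simp only [mul_assoc]
  have e2 : (s * X.conjTranspose * (s * X)).trace = (X.conjTranspose * s * X * s).trace := by
    rw [mul_assoc, Matrix.trace_mul_comm]; simp only [mul_assoc]
  have e3 : (X.conjTranspose * s * (X * s)).trace = (X.conjTranspose * s * X * s).trace := by
    simp only [mul_assoc]
  have e4 : (s * X.conjTranspose * (X * s)).trace = (s * (X.conjTranspose * X) * s).trace := by
    simp only [mul_assoc]
  simp only [Matrix.conjTranspose_sub, Matrix.conjTranspose_mul, hsH, sub_mul, mul_sub, Matrix.trace_sub,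
    e1, e2, e3, e4, Complex.sub_re, Complex.zero_re] at h1
  refine abs_le_of_sq_le_sq' ?_ (norm_nonneg _) |>.2
  rw [h0]
  simp only [Complex.one_re, mul_one] at h2 h3
  linarith

/-- The commutator with `O`, embedded isometrically for the KMS norm. -/
def commEmbed (H : Matrix m m ℂ) (β : ℝ) (O : Matrix m m ℂ) :
    Matrix m m ℂ →ₗ[ℂ] EuclideanSpace ℂ (m × m) :=
  kmsEmbed H β ∘ₗ (LinearMap.mulRight ℂ O - LinearMap.mulLeft ℂ O)

theorem commEmbed_apply (β : ℝ) (O X : Matrix m m ℂ) :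
    commEmbed H β O X = kmsEmbed H β (X * O - O * X) := rfl

theorem norm_commEmbed_le [Nonempty m] (hH : H.IsHermitian) (β : ℝ) {O : Matrix m m ℂ} (hO : ‖O‖ ≤ 1)
    (X : Matrix m m ℂ) : ‖commEmbed H β O X‖ ≤ 2 * ‖X‖ := by
  refine (norm_kmsEmbed_le hH β _).trans ((norm_sub_le _ _).trans ?_)
  have h1 := norm_mul_le X O
  have h2 := norm_mul_le O X
  change ‖X * O‖ + ‖O * X‖ ≤ _
  nlinarith [norm_nonneg X]

theorem dirichletForm_eq_sum [Nonempty m] (hH : H.IsHermitian) {β σ : ℝ} (hβ : 0 < β) (hσ : 0 < σ)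
    {A : Matrix m m ℂ} (hA : A.IsHermitian) (O : Matrix m m ℂ) :
    dirichletForm hH β σ A O O =
      ∑ ν₁ ∈ bohrFreqs hH, ∑ ν₂ ∈ bohrFreqs hH, (dirichletWeight β σ ν₁ ν₂ : ℂ) *
        inner ℂ (commEmbed H β O (bohrComponent hH A ν₁)) (commEmbed H β O (bohrComponent hH A ν₂)) := by
  rw [dirichletForm, neg_kmsInner_hsAdjoint_eq_sum_commutator hH A O hβ hσ hA (sqrt_gibbs hH β)
    (isHermitian_gibbsSqrt hH β) (gibbsSqrt_mul_bohrComponent hH β A)]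
  simp only [commEmbed_apply, inner_kmsEmbed hH]

end Gibbs

/-! ### The Fourier transform of the hyperbolic secant. -/

section HyperbolicSecant

theorem sigmoid_smul_beta_integrand (y s : ℝ) :
    |Real.sigmoid s * (1 - Real.sigmoid s)| •
      (((Real.sigmoid s : ℝ) : ℂ) ^ ((1 / 2 + Complex.I * y) - 1) *
        (1 - ((Real.sigmoid s : ℝ) : ℂ)) ^ ((1 / 2 - Complex.I * y) - 1)) =
      Complex.exp (Complex.I * y * s) * ((1 / (2 * Real.cosh (s / 2)) : ℝ) : ℂ) := by
  have hc : 0 < 2 * Real.cosh (s / 2) := by positivity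
  -- With this `L`, the sigmoid is `e^{s/2-L}` and its complement `e^{-s/2-L}`, so all complex
  -- powers become exponentials.
  obtain ⟨L, hL⟩ : ∃ L, 2 * Real.cosh (s / 2) = Real.exp L := ⟨_, (Real.exp_log hc).symm⟩
  have h1 : Real.sigmoid s = Real.exp (s / 2 - L) := by
    rw [Real.exp_sub, ← hL, Real.sigmoid_def, inv_eq_one_div, div_eq_div_iff (by positivity) hc.ne',
      Real.cosh_eq]
    have : Real.exp (s / 2) * Real.exp (-s) = Real.exp (-(s / 2)) := by
      rw [← Real.exp_add]; ring_nf
    rw [mul_add, this]; ring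
  have h2 : 1 - Real.sigmoid s = Real.exp (-(s / 2) - L) := by
    rw [h1, Real.exp_sub, Real.exp_sub, ← hL, eq_div_iff hc.ne', sub_mul, div_mul_cancel₀ _ hc.ne',
      Real.cosh_eq]
    ring
  have h3 : (1 - ((Real.sigmoid s : ℝ) : ℂ)) = ((Real.exp (-(s / 2) - L) : ℝ) : ℂ) := by
    rw [← h2]; push_cast; rfl
  rw [h3, h2, h1, hL, abs_of_pos (by positivity), one_div (Real.exp L), ← Real.exp_neg, Complex.real_smul,
    Complex.cpow_def_of_ne_zero (by exact_mod_cast (Real.exp_pos _).ne'),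
    Complex.cpow_def_of_ne_zero (by exact_mod_cast (Real.exp_pos _).ne'),
    ← Complex.ofReal_log (Real.exp_pos _).le, ← Complex.ofReal_log (Real.exp_pos _).le,
    Real.log_exp, Real.log_exp, ← Real.exp_add, Complex.ofReal_exp, Complex.ofReal_exp,
    ← Complex.exp_add, ← Complex.exp_add, ← Complex.exp_add]
  congr 1
  push_cast
  ring

/-- The substitution `x = sigmoid s` turns the Beta integral `B(½+iy, ½-iy)` into this one, and the
reflection formula evaluates it as `π / sin(π(½+iy)) = π / cosh(πy)`. -/
theorem integrable_and_integral_cexp_mul_sech (y : ℝ) :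
    Integrable (fun s : ℝ =>
      Complex.exp (Complex.I * y * s) * ((1 / (2 * Real.cosh (s / 2)) : ℝ) : ℂ)) ∧
    ∫ s : ℝ, Complex.exp (Complex.I * y * s) * ((1 / (2 * Real.cosh (s / 2)) : ℝ) : ℂ) =
      (Real.pi / Real.cosh (Real.pi * y) : ℝ) := by
  have hu : 0 < (1 / 2 + Complex.I * y : ℂ).re := by simp
  have hv : 0 < (1 / 2 - Complex.I * y : ℂ).re := by simp
  have himg : Real.sigmoid '' Set.univ = Set.Ioo 0 1 := by rw [Set.image_univ, Real.range_sigmoid]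
  have hder : ∀ x ∈ Set.univ, HasDerivWithinAt Real.sigmoid
      (Real.sigmoid x * (1 - Real.sigmoid x)) Set.univ x := fun x _ =>
    (Real.hasDerivAt_sigmoid x).hasDerivWithinAt
  have hinj : Set.InjOn Real.sigmoid Set.univ := Real.sigmoid_injective.injOn
  have h1 := Complex.betaIntegral_convergent hu hv
  rw [intervalIntegrable_iff_integrableOn_Ioo_of_le zero_le_one, ← himg,
    integrableOn_image_iff_integrableOn_abs_deriv_smul MeasurableSet.univ hder hinj] at h1
  simp only [sigmoid_smul_beta_integrand, integrableOn_univ] at h1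
  refine ⟨h1, ?_⟩
  have h2 : Complex.betaIntegral (1 / 2 + Complex.I * y) (1 / 2 - Complex.I * y) =
      ∫ s : ℝ, Complex.exp (Complex.I * y * s) * ((1 / (2 * Real.cosh (s / 2)) : ℝ) : ℂ) := by
    rw [Complex.betaIntegral, intervalIntegral.integral_of_le zero_le_one,
      integral_Ioc_eq_integral_Ioo, ← himg,
      integral_image_eq_integral_abs_deriv_smul MeasurableSet.univ hder hinj]
    simp only [sigmoid_smul_beta_integrand, Measure.restrict_univ]
  have h3 := Complex.Gamma_mul_Gamma_eq_betaIntegral hu hv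
  have e1 : (1 / 2 - Complex.I * y : ℂ) = 1 - (1 / 2 + Complex.I * y) := by ring
  rw [add_add_sub_cancel, add_halves, Complex.Gamma_one, one_mul, h2] at h3
  rw [← h3, e1, Complex.Gamma_mul_Gamma_one_sub]
  push_cast
  congr 1
  rw [mul_add, ← Complex.cos_mul_I, mul_one_div, add_comm, Complex.sin_add_pi_div_two]
  congr 1; ring

theorem gKernel_pos {β : ℝ} (hβ : 0 < β) (t : ℝ) : 0 < gKernel β t := by
  unfold gKernel; positivity

theorem gKernel_one_le {β : ℝ} (hβ : 0 < β) {t : ℝ} (ht : |t| ≤ 1) : gKernel β 1 ≤ gKernel β t := by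
  unfold gKernel
  refine one_div_le_one_div_of_le (by positivity) (mul_le_mul_of_nonneg_left ?_ hβ.le)
  rw [Real.cosh_le_cosh, abs_div, abs_div, abs_mul, abs_mul]
  gcongr
  simpa using ht

theorem integrable_and_integral_cexp_mul_gKernel {β : ℝ} (hβ : 0 < β) (ν : ℝ) :
    Integrable (fun t : ℝ => Complex.exp (Complex.I * ν * t) * (gKernel β t : ℂ)) ∧
    ∫ t : ℝ, Complex.exp (Complex.I * ν * t) * (gKernel β t : ℂ) =
      (1 / (2 * Real.cosh (β * ν / 4)) : ℝ) := by
  obtain ⟨h1, h2⟩ := integrable_and_integral_cexp_mul_sech (ν * β / (4 * Real.pi))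
  have hp := Real.pi_pos
  have hk : 0 < 4 * Real.pi / β := by positivity
  have he : ∀ t : ℝ, Complex.exp (Complex.I * ν * t) * (gKernel β t : ℂ) =
      ((2 / β : ℝ) : ℂ) * (Complex.exp (Complex.I * (ν * β / (4 * Real.pi) : ℝ) * (4 * Real.pi / β * t : ℝ)) *
        ((1 / (2 * Real.cosh ((4 * Real.pi / β * t) / 2)) : ℝ) : ℂ)) := fun t => by
    have e1 : Complex.I * (ν * β / (4 * Real.pi) : ℝ) * (4 * Real.pi / β * t : ℝ) = Complex.I * ν * t := by
      rw [mul_assoc, mul_assoc, ← Complex.ofReal_mul, ← Complex.ofReal_mul]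
      congr 2; field_simp
    have e2 : gKernel β t = 2 / β * (1 / (2 * Real.cosh ((4 * Real.pi / β * t) / 2))) := by
      rw [gKernel]
      have : 4 * Real.pi / β * t / 2 = 2 * Real.pi * t / β := by ring
      rw [this]; field_simp
    rw [e1, e2]; push_cast; ring
  simp_rw [he]
  refine ⟨(h1.comp_mul_left' hk.ne').const_mul _, ?_⟩
  rw [integral_const_mul, Measure.integral_comp_mul_left (fun s : ℝ =>
    Complex.exp (Complex.I * (ν * β / (4 * Real.pi) : ℝ) * s) *
      ((1 / (2 * Real.cosh (s / 2)) : ℝ) : ℂ)), h2, abs_of_pos (by positivity), Complex.real_smul,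
    ← Complex.ofReal_mul, ← Complex.ofReal_mul]
  congr 1
  have : Real.pi * (ν * β / (4 * Real.pi)) = β * ν / 4 := by field_simp
  rw [this]
  field_simp
  ring

end HyperbolicSecant

/-! ### The energy as a positive double integral, and the low-frequency bound. -/

section EnergyBound

variable {W : Type*} [NormedAddCommGroup W] [InnerProductSpace ℂ W]

theorem norm_sq_sum_smul (S : Finset ℝ) (c : ℝ → ℂ) (v : ℝ → W) :
    ((‖∑ ν ∈ S, c ν • v ν‖ ^ 2 : ℝ) : ℂ) =
      ∑ ν₁ ∈ S, ∑ ν₂ ∈ S, (starRingEnd ℂ (c ν₁) * c ν₂) * inner ℂ (v ν₁) (v ν₂) := by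
  have h := inner_self_eq_norm_sq_to_K (𝕜 := ℂ) (∑ ν ∈ S, c ν • v ν)
  push_cast
  refine (Eq.symm h).trans ?_
  rw [sum_inner]
  refine Finset.sum_congr rfl fun ν₁ _ => ?_
  rw [inner_sum]
  refine Finset.sum_congr rfl fun ν₂ _ => ?_
  rw [inner_smul_left, inner_smul_right]
  ring

/-- The Cauchy–Schwarz inequality for a weighted vector-valued integral. -/
theorem sq_norm_integral_le [CompleteSpace W] {μ : Measure ℝ} {F : ℝ → W} {p : ℝ → ℝ} {a : ℝ}
    (hp : ∀ x, 0 < p x) (hF : Integrable F μ) (hpi : Integrable (fun x => (p x)⁻¹) μ)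
    (hpF : Integrable (fun x => p x * ‖F x‖ ^ 2) μ) (ha : 0 < a) (hle : ∫ x, (p x)⁻¹ ∂μ ≤ a) :
    ‖∫ x, F x ∂μ‖ ^ 2 ≤ a * ∫ x, p x * ‖F x‖ ^ 2 ∂μ := by
  set I := ∫ x, ‖F x‖ ∂μ
  set b := ∫ x, p x * ‖F x‖ ^ 2 ∂μ with hb
  have hb0 : 0 ≤ b := integral_nonneg fun x => mul_nonneg (hp x).le (sq_nonneg _)
  have hI : ‖∫ x, F x ∂μ‖ ≤ I := norm_integral_le_integral_norm _
  have hI0 : 0 ≤ I := (norm_nonneg _).trans hI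
  refine (pow_le_pow_left₀ (norm_nonneg _) hI 2).trans ?_
  rcases hI0.eq_or_lt with h0 | h0
  · rw [← h0]; simpa using mul_nonneg ha.le hb0
  -- Pointwise `2‖F‖ ≤ l/p + p‖F‖²/l`; the value `l = I/a` taken below then gives `I² ≤ ab`.
  have key : ∀ l : ℝ, 0 < l → 2 * I ≤ l * a + l⁻¹ * b := fun l hl => by
    have h1 : 2 * I ≤ l * ∫ x, (p x)⁻¹ ∂μ + l⁻¹ * b := by
      rw [hb, ← integral_const_mul, ← integral_const_mul, ← integral_const_mul,
        ← integral_add (hpi.const_mul _) (hpF.const_mul _)]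
      refine integral_mono (hF.norm.const_mul _) ((hpi.const_mul _).add (hpF.const_mul _)) fun x => ?_
      have hx := hp x
      have h2 : l * (p x)⁻¹ + l⁻¹ * (p x * ‖F x‖ ^ 2) - 2 * ‖F x‖ =
          l * (p x)⁻¹ * (1 - l⁻¹ * p x * ‖F x‖) ^ 2 := by
        field_simp; ring
      have h3 : 0 ≤ l * (p x)⁻¹ * (1 - l⁻¹ * p x * ‖F x‖) ^ 2 := by positivity
      change 2 * ‖F x‖ ≤ l * (p x)⁻¹ + l⁻¹ * (p x * ‖F x‖ ^ 2)
      linarith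
    nlinarith
  have h := key (I / a) (by positivity)
  rw [div_mul_cancel₀ _ ha.ne', inv_div] at h
  have h4 : I ≤ a / I * b := by linarith
  calc I ^ 2 = I * I := sq I
    _ ≤ I * (a / I * b) := mul_le_mul_of_nonneg_left h4 h0.le
    _ = a * b := by field_simp

/-- The average of `e^{iνt}` over `|t| ≤ τ`. -/
def avgCoeff (τ ν : ℝ) : ℂ := ((1 / (2 * τ) : ℝ) : ℂ) * ∫ t in Set.Icc (-τ) τ, Complex.exp (Complex.I * ν * t)

theorem integrable_gKernel_mul_norm_sq {β : ℝ} (hβ : 0 < β) (S : Finset ℝ) (c : ℝ → ℂ) (v : ℝ → W) :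
    Integrable (fun t => gKernel β t * ‖∑ ν ∈ S, (c ν * Complex.exp (Complex.I * ν * t)) • v ν‖ ^ 2) ∧
    ((∫ t, gKernel β t * ‖∑ ν ∈ S, (c ν * Complex.exp (Complex.I * ν * t)) • v ν‖ ^ 2 : ℝ) : ℂ) =
      ∑ ν₁ ∈ S, ∑ ν₂ ∈ S, ((1 / (2 * Real.cosh (β * (ν₁ - ν₂) / 4)) : ℝ) : ℂ) *
        ((starRingEnd ℂ (c ν₁) * c ν₂) * inner ℂ (v ν₁) (v ν₂)) := by
  have h1 : ∀ t : ℝ, ((gKernel β t * ‖∑ ν ∈ S, (c ν * Complex.exp (Complex.I * ν * t)) • v ν‖ ^ 2 : ℝ) : ℂ)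
      = ∑ ν₁ ∈ S, ∑ ν₂ ∈ S, (Complex.exp (Complex.I * (ν₂ - ν₁ : ℝ) * t) * (gKernel β t : ℂ)) *
        ((starRingEnd ℂ (c ν₁) * c ν₂) * inner ℂ (v ν₁) (v ν₂)) := fun t => by
    rw [Complex.ofReal_mul, norm_sq_sum_smul, Finset.mul_sum]
    refine Finset.sum_congr rfl fun ν₁ _ => ?_
    rw [Finset.mul_sum]
    refine Finset.sum_congr rfl fun ν₂ _ => ?_
    have : Complex.exp (Complex.I * (ν₂ - ν₁ : ℝ) * t) =
        starRingEnd ℂ (Complex.exp (Complex.I * ν₁ * t)) * Complex.exp (Complex.I * ν₂ * t) := by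
      rw [← Complex.exp_conj, ← Complex.exp_add]
      congr 1
      simp only [map_mul, Complex.conj_I, Complex.conj_ofReal]
      push_cast; ring
    rw [this, map_mul]; ring
  have hint : ∀ ν₁ ν₂ : ℝ, Integrable fun t : ℝ =>
      (Complex.exp (Complex.I * (ν₂ - ν₁ : ℝ) * t) * (gKernel β t : ℂ)) *
        ((starRingEnd ℂ (c ν₁) * c ν₂) * inner ℂ (v ν₁) (v ν₂)) := fun ν₁ ν₂ =>
    (integrable_and_integral_cexp_mul_gKernel hβ _).1.mul_const _
  have hint2 : Integrable fun t : ℝ => ∑ ν₁ ∈ S, ∑ ν₂ ∈ S,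
      (Complex.exp (Complex.I * (ν₂ - ν₁ : ℝ) * t) * (gKernel β t : ℂ)) *
        ((starRingEnd ℂ (c ν₁) * c ν₂) * inner ℂ (v ν₁) (v ν₂)) :=
    integrable_finsetSum _ fun ν₁ _ => integrable_finsetSum _ fun ν₂ _ => hint ν₁ ν₂
  refine ⟨?_, ?_⟩
  · simp_rw [← h1] at hint2
    exact hint2.re
  · rw [← integral_complex_ofReal]
    refine (integral_congr_ae (Filter.Eventually.of_forall h1)).trans ?_
    rw [integral_finsetSum _ fun ν₁ _ => integrable_finsetSum _ fun ν₂ _ => hint ν₁ ν₂]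
    refine Finset.sum_congr rfl fun ν₁ _ => ?_
    rw [integral_finsetSum _ fun ν₂ _ => hint ν₁ ν₂]
    refine Finset.sum_congr rfl fun ν₂ _ => ?_
    rw [integral_mul_const, (integrable_and_integral_cexp_mul_gKernel hβ _).2]
    congr 4
    rw [← Real.cosh_neg]
    congr 1; ring

theorem continuous_sum_cexp_smul (S : Finset ℝ) (c : ℝ → ℂ) (v : ℝ → W) :
    Continuous fun t : ℝ => ∑ ν ∈ S, (c ν * Complex.exp (Complex.I * ν * t)) • v ν := by fun_prop

theorem integral_sum_cexp_smul [CompleteSpace W] {τ : ℝ} (hτ : 0 < τ) (S : Finset ℝ) (c : ℝ → ℂ) (v : ℝ → W) :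
    ∫ t in Set.Icc (-τ) τ, ∑ ν ∈ S, (c ν * Complex.exp (Complex.I * ν * t)) • v ν =
      ((2 * τ : ℝ) : ℂ) • ∑ ν ∈ S, (c ν * avgCoeff τ ν) • v ν := by
  have hint : ∀ ν : ℝ, IntegrableOn (fun t : ℝ => (c ν * Complex.exp (Complex.I * ν * t)) • v ν)
      (Set.Icc (-τ) τ) := fun ν => Continuous.integrableOn_Icc (by fun_prop)
  rw [integral_finsetSum _ fun ν _ => hint ν, Finset.smul_sum]
  refine Finset.sum_congr rfl fun ν _ => ?_
  rw [integral_smul_const, integral_const_mul, smul_smul, avgCoeff]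
  congr 1
  have : (τ : ℂ) ≠ 0 := by exact_mod_cast hτ.ne'
  push_cast
  field_simp

/-- On `|t| ≤ τ ≤ 1` the kernel is at least `g(1)`; this is the source of `g(1)` in the final
estimate. Unweighted Cauchy–Schwarz on the window then compares the average with the mean square. -/
theorem gKernel_mul_norm_sq_avg_le [CompleteSpace W] {β τ : ℝ} (hβ : 0 < β) (hτ : 0 < τ) (hτ1 : τ ≤ 1)
    (S : Finset ℝ) (c : ℝ → ℂ) (v : ℝ → W) :
    2 * τ * gKernel β 1 * ‖∑ ν ∈ S, (c ν * avgCoeff τ ν) • v ν‖ ^ 2 ≤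
      ∫ t, gKernel β t * ‖∑ ν ∈ S, (c ν * Complex.exp (Complex.I * ν * t)) • v ν‖ ^ 2 := by
  set F : ℝ → W := fun t => ∑ ν ∈ S, (c ν * Complex.exp (Complex.I * ν * t)) • v ν with hF
  have hFc : Continuous F := continuous_sum_cexp_smul S c v
  have hi := (integrable_gKernel_mul_norm_sq hβ S c v).1
  have hg1 := gKernel_pos hβ 1
  have h1 : ∫ t in Set.Icc (-τ) τ, gKernel β 1 * ‖F t‖ ^ 2 ≤ ∫ t, gKernel β t * ‖F t‖ ^ 2 := by
    refine le_trans (setIntegral_mono_on (Continuous.integrableOn_Icc (by fun_prop)) hi.integrableOn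
      measurableSet_Icc fun t ht => ?_) (setIntegral_le_integral hi (Filter.Eventually.of_forall
        fun t => mul_nonneg (gKernel_pos hβ t).le (sq_nonneg _)))
    exact mul_le_mul_of_nonneg_right (gKernel_one_le hβ ((abs_le.2 ht).trans hτ1)) (sq_nonneg _)
  have h2 := sq_norm_integral_le (μ := volume.restrict (Set.Icc (-τ) τ)) (F := F) (p := fun _ => 1)
    (a := 2 * τ) (fun _ => one_pos) hFc.integrableOn_Icc
    (Continuous.integrableOn_Icc (by fun_prop)) (Continuous.integrableOn_Icc (by fun_prop))
    (by positivity) (by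
      simp only [inv_one, integral_const, smul_eq_mul, mul_one, MeasurableSet.univ,
        measureReal_restrict_apply, Set.univ_inter, Real.volume_real_Icc]
      rw [max_eq_left (by linarith)]; linarith)
  rw [hF, integral_sum_cexp_smul hτ, norm_smul, ← hF, mul_pow, Complex.norm_real, Real.norm_of_nonneg (by positivity)] at h2
  simp only [one_mul] at h2
  rw [integral_const_mul] at h1
  refine le_trans ?_ h1
  have h3 : 2 * τ * ‖∑ ν ∈ S, (c ν * avgCoeff τ ν) • v ν‖ ^ 2 ≤ ∫ t in Set.Icc (-τ) τ, ‖F t‖ ^ 2 := by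
    refine le_of_mul_le_mul_left (a := 2 * τ) ?_ (by positivity)
    linarith
  nlinarith

/-- The energy at frequency `u`. -/
def energyDensity (β σ : ℝ) (S : Finset ℝ) (v : ℝ → W) (u : ℝ) : ℝ :=
  ∫ t, gKernel β t * ‖∑ ν ∈ S, ((filterFreq σ (u - ν) : ℂ) * Complex.exp (Complex.I * ν * t)) • v ν‖ ^ 2

theorem energyDensity_nonneg {β : ℝ} (hβ : 0 < β) (σ : ℝ) (S : Finset ℝ) (v : ℝ → W) (u : ℝ) :
    0 ≤ energyDensity β σ S v u :=
  integral_nonneg fun t => mul_nonneg (gKernel_pos hβ t).le (sq_nonneg _)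

/-- Both factors of `dirichletWeight` are integrals of rank-one kernels in `(ν₁, ν₂)`, so the
quadratic form is an integral of squared norms. Positivity of the Dirichlet form follows. -/
theorem integrable_exp_mul_energyDensity {β σ : ℝ} (hβ : 0 < β) (hσ : 0 < σ) (S : Finset ℝ) (v : ℝ → W) :
    Integrable (fun u => Real.exp (-(β / 2 * |u|)) * energyDensity β σ S v u) ∧
    ((Real.exp (-(β ^ 2 * σ ^ 2 / 8)) *
        ∫ u, Real.exp (-(β / 2 * |u|)) * energyDensity β σ S v u : ℝ) : ℂ) =
      ∑ ν₁ ∈ S, ∑ ν₂ ∈ S, (dirichletWeight β σ ν₁ ν₂ : ℂ) * inner ℂ (v ν₁) (v ν₂) := by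
  have h1 : ∀ u : ℝ, ((Real.exp (-(β / 2 * |u|)) * energyDensity β σ S v u : ℝ) : ℂ)
      = ∑ ν₁ ∈ S, ∑ ν₂ ∈ S,
        ((Real.exp (-(β / 2 * |u|)) * filterFreq σ (u - ν₁) * filterFreq σ (u - ν₂) : ℝ) : ℂ) *
        (((1 / (2 * Real.cosh (β * (ν₁ - ν₂) / 4)) : ℝ) : ℂ) * inner ℂ (v ν₁) (v ν₂)) := fun u => by
    rw [Complex.ofReal_mul, energyDensity, (integrable_gKernel_mul_norm_sq hβ S _ v).2, Finset.mul_sum]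
    refine Finset.sum_congr rfl fun ν₁ _ => ?_
    rw [Finset.mul_sum]
    refine Finset.sum_congr rfl fun ν₂ _ => ?_
    rw [Complex.conj_ofReal, Complex.ofReal_mul, Complex.ofReal_mul]
    ring
  have hint' : ∀ ν₁ ν₂ : ℝ, Integrable fun u : ℝ =>
      ((Real.exp (-(β / 2 * |u|)) * filterFreq σ (u - ν₁) * filterFreq σ (u - ν₂) : ℝ) : ℂ) :=
    fun ν₁ ν₂ => (integrable_weight_mul_filterFreq hσ (w := fun u => Real.exp (-(β / 2 * |u|)))
      (by fun_prop) (fun _ => (Real.exp_pos _).le) (fun u => by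
        rw [Real.exp_le_one_iff, neg_nonpos]; positivity) ν₁ ν₂).ofReal
  have hint : ∀ ν₁ ν₂ : ℝ, Integrable fun u : ℝ =>
      ((Real.exp (-(β / 2 * |u|)) * filterFreq σ (u - ν₁) * filterFreq σ (u - ν₂) : ℝ) : ℂ) *
        (((1 / (2 * Real.cosh (β * (ν₁ - ν₂) / 4)) : ℝ) : ℂ) * inner ℂ (v ν₁) (v ν₂)) :=
    fun ν₁ ν₂ => (hint' ν₁ ν₂).mul_const _
  have hint2 : Integrable fun u : ℝ => ∑ ν₁ ∈ S, ∑ ν₂ ∈ S,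
      ((Real.exp (-(β / 2 * |u|)) * filterFreq σ (u - ν₁) * filterFreq σ (u - ν₂) : ℝ) : ℂ) *
        (((1 / (2 * Real.cosh (β * (ν₁ - ν₂) / 4)) : ℝ) : ℂ) * inner ℂ (v ν₁) (v ν₂)) :=
    integrable_finsetSum _ fun ν₁ _ => integrable_finsetSum _ fun ν₂ _ => hint ν₁ ν₂
  refine ⟨?_, ?_⟩
  · simp_rw [← h1] at hint2
    exact hint2.re
  · rw [Complex.ofReal_mul, ← integral_complex_ofReal]
    rw [integral_congr_ae (Filter.Eventually.of_forall h1)]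
    rw [integral_finsetSum _ fun ν₁ _ => integrable_finsetSum _ fun ν₂ _ => hint ν₁ ν₂, Finset.mul_sum]
    refine Finset.sum_congr rfl fun ν₁ _ => ?_
    rw [integral_finsetSum _ fun ν₂ _ => hint ν₁ ν₂, Finset.mul_sum]
    refine Finset.sum_congr rfl fun ν₂ _ => ?_
    rw [integral_mul_const, dirichletWeight, symmCoeff, Complex.ofReal_mul, Complex.ofReal_mul, ← integral_complex_ofReal]
    ring

theorem integral_exp_abs_le {β Ω : ℝ} (hβ : 0 < β) (hΩ : 0 ≤ Ω) :
    ∫ u in Set.Icc (-Ω) Ω, Real.exp (β / 2 * |u|) ≤ 4 / β * Real.exp (β * Ω / 2) := by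
  have h1 : ∫ u in Set.Icc (-Ω) Ω, Real.exp (β / 2 * |u|) ≤
      ∫ u in Set.Icc (-Ω) Ω, (Real.exp (β / 2 * u) + Real.exp (-(β / 2) * u)) := by
    refine setIntegral_mono_on (Continuous.integrableOn_Icc (by fun_prop))
      (Continuous.integrableOn_Icc (by fun_prop)) measurableSet_Icc fun u _ => ?_
    rcases abs_cases u with ⟨h, _⟩ | ⟨h, _⟩ <;> rw [h]
    · linarith [Real.exp_pos (-(β / 2) * u)]
    · rw [mul_neg, ← neg_mul]; linarith [Real.exp_pos ((β / 2) * u)]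
  refine h1.trans ?_
  rw [integral_Icc_eq_integral_Ioc, ← intervalIntegral.integral_of_le (by linarith),
    intervalIntegral.integral_add (Continuous.intervalIntegrable (by fun_prop) _ _)
      (Continuous.intervalIntegrable (by fun_prop) _ _),
    intervalIntegral.integral_comp_mul_left (fun x => Real.exp x) (by positivity),
    intervalIntegral.integral_comp_mul_left (fun x => Real.exp x) (by simpa using hβ.ne'),
    integral_exp, integral_exp]
  have e1 : -(β / 2) * -Ω = β / 2 * Ω := by ring
  have e2 : β * Ω / 2 = β / 2 * Ω := by ring
  have e3 : -(β / 2) * Ω = β / 2 * -Ω := by ring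
  rw [e1, e2, e3, smul_eq_mul, smul_eq_mul]
  have : (β / 2)⁻¹ * (Real.exp (β / 2 * Ω) - Real.exp (β / 2 * -Ω)) +
      (-(β / 2))⁻¹ * (Real.exp (β / 2 * -Ω) - Real.exp (β / 2 * Ω)) =
      4 / β * (Real.exp (β / 2 * Ω) - Real.exp (β / 2 * -Ω)) := by field_simp; ring
  rw [this]
  exact mul_le_mul_of_nonneg_left (by linarith [Real.exp_pos (β / 2 * -Ω)]) (by positivity)

/-- The low-frequency part of the filter. -/
def lowCoeff (σ Ω ν : ℝ) : ℝ := ∫ u in Set.Icc (-Ω) Ω, filterFreq σ (u - ν)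

theorem norm_sq_low_le [CompleteSpace W] {β σ τ Ω : ℝ} (hβ : 0 < β) (hσ : 0 < σ) (hτ : 0 < τ)
    (hτ1 : τ ≤ 1) (hΩ : 0 ≤ Ω) (S : Finset ℝ) (v : ℝ → W) {E : ℝ}
    (hE : ∑ ν₁ ∈ S, ∑ ν₂ ∈ S, (dirichletWeight β σ ν₁ ν₂ : ℂ) * inner ℂ (v ν₁) (v ν₂) = E) :
    ‖∑ ν ∈ S, ((lowCoeff σ Ω ν : ℂ) * avgCoeff τ ν) • v ν‖ ^ 2 ≤
      4 / β * Real.exp (β * Ω / 2) * (Real.exp (β ^ 2 * σ ^ 2 / 8) * E / (2 * τ * gKernel β 1)) := by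
  obtain ⟨hi, hE'⟩ := integrable_exp_mul_energyDensity hβ hσ S v
  rw [hE] at hE'
  have hE2 : Real.exp (-(β ^ 2 * σ ^ 2 / 8)) *
        ∫ u, Real.exp (-(β / 2 * |u|)) * energyDensity β σ S v u = E := by exact_mod_cast hE'
  set F : ℝ → W := fun u => ∑ ν ∈ S, ((filterFreq σ (u - ν) : ℂ) * avgCoeff τ ν) • v ν with hF
  have hcf := continuous_filterFreq σ
  have hFc : Continuous F := by
    refine continuous_finsetSum _ fun ν _ => ?_
    have : Continuous fun u => filterFreq σ (u - ν) := hcf.comp (by fun_prop)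
    fun_prop
  have hg1 := gKernel_pos hβ 1
  have hFint : ∫ u in Set.Icc (-Ω) Ω, F u = ∑ ν ∈ S, ((lowCoeff σ Ω ν : ℂ) * avgCoeff τ ν) • v ν := by
    have hint : ∀ ν : ℝ, IntegrableOn (fun u : ℝ => ((filterFreq σ (u - ν) : ℂ) * avgCoeff τ ν) • v ν)
        (Set.Icc (-Ω) Ω) := fun ν => by
      have : Continuous fun u => filterFreq σ (u - ν) := hcf.comp (by fun_prop)
      exact Continuous.integrableOn_Icc (by fun_prop)
    rw [hF, integral_finsetSum _ fun ν _ => hint ν]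
    refine Finset.sum_congr rfl fun ν _ => ?_
    rw [integral_smul_const, integral_mul_const, lowCoeff]
    congr 2
    exact integral_ofReal
  -- Cauchy–Schwarz in `u` against the weight of the energy; the reciprocal weight integrates to at
  -- most `(4/β) e^{βΩ/2}`.
  have h1 := sq_norm_integral_le (μ := volume.restrict (Set.Icc (-Ω) Ω)) (F := F)
    (p := fun u => Real.exp (-(β / 2 * |u|))) (a := 4 / β * Real.exp (β * Ω / 2))
    (fun _ => Real.exp_pos _) hFc.integrableOn_Icc
    (by
      simp only [← Real.exp_neg, neg_neg]
      exact Continuous.integrableOn_Icc (by fun_prop))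
    (Continuous.integrableOn_Icc (by fun_prop)) (by positivity)
    (by simpa only [← Real.exp_neg, neg_neg] using integral_exp_abs_le hβ hΩ)
  rw [hFint] at h1
  refine h1.trans (mul_le_mul_of_nonneg_left ?_ (by positivity))
  have h2 : 2 * τ * gKernel β 1 * ∫ u in Set.Icc (-Ω) Ω, Real.exp (-(β / 2 * |u|)) * ‖F u‖ ^ 2 ≤
      ∫ u, Real.exp (-(β / 2 * |u|)) * energyDensity β σ S v u := by
    rw [← integral_const_mul]
    refine le_trans (setIntegral_mono_on (Continuous.integrableOn_Icc (by fun_prop)) hi.integrableOn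
      measurableSet_Icc fun u _ => ?_) (setIntegral_le_integral hi (Filter.Eventually.of_forall
        fun u => mul_nonneg (Real.exp_pos _).le (energyDensity_nonneg hβ _ _ _ _)))
    have := gKernel_mul_norm_sq_avg_le hβ hτ hτ1 S (fun ν => (filterFreq σ (u - ν) : ℂ)) v
    calc _ = Real.exp (-(β / 2 * |u|)) * (2 * τ * gKernel β 1 * ‖F u‖ ^ 2) := by ring
      _ ≤ _ := mul_le_mul_of_nonneg_left this (Real.exp_pos _).le
  rw [le_div_iff₀ (by positivity), mul_comm, ← hE2, ← mul_assoc (Real.exp _), ← Real.exp_add, add_neg_cancel,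
    Real.exp_zero, one_mul]
  exact h2

end EnergyBound

/-! ### Multipliers of a contractive flow: frequency decay and time averaging. -/

section Flow

variable {V : Type*} [NormedAddCommGroup V] [NormedSpace ℂ V] [CompleteSpace V] {S : Finset ℝ} {a : ℝ → V}

/-- A family `a` is flow-bounded if the flow `∑ c_ν a_ν ↦ ∑ c_ν e^{iνt} a_ν` is a contraction for every `t`. -/
def FlowBounded (S : Finset ℝ) (a : ℝ → V) : Prop :=
  ∀ (c : ℝ → ℂ) (t : ℝ), ‖∑ ν ∈ S, (c ν * Complex.exp (Complex.I * ν * t)) • a ν‖ ≤ ‖∑ ν ∈ S, c ν • a ν‖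

theorem norm_cexp_I_mul_mul (ν t : ℝ) : ‖Complex.exp (Complex.I * ν * t)‖ = 1 := by
  rw [mul_assoc, ← Complex.ofReal_mul, Complex.norm_exp_I_mul_ofReal]

/-- A multiplier that is the Fourier transform of `ψ` is an average of the flow with density `ψ`, so
its norm is at most the `L¹` norm of `ψ`, however many frequencies occur. -/
theorem FlowBounded.norm_sum_integral_le (h : FlowBounded S a) {μ : Measure ℝ} {ψ : ℝ → ℂ} (hψ : Integrable ψ μ)
    (c : ℝ → ℂ) :
    ‖∑ ν ∈ S, (c ν * ∫ t, Complex.exp (Complex.I * ν * t) * ψ t ∂μ) • a ν‖ ≤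
      (∫ t, ‖ψ t‖ ∂μ) * ‖∑ ν ∈ S, c ν • a ν‖ := by
  have hi : ∀ ν : ℝ, Integrable (fun t : ℝ => Complex.exp (Complex.I * ν * t) * ψ t) μ := fun ν => by
    refine hψ.bdd_mul (c := 1) ?_ ?_
    · exact (by fun_prop : Continuous fun t : ℝ => Complex.exp (Complex.I * ν * t)).aestronglyMeasurable
    · exact Filter.Eventually.of_forall fun t => (norm_cexp_I_mul_mul ν t).le
  have h1 : ∑ ν ∈ S, (c ν * ∫ t, Complex.exp (Complex.I * ν * t) * ψ t ∂μ) • a ν =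
      ∫ t, ψ t • ∑ ν ∈ S, (c ν * Complex.exp (Complex.I * ν * t)) • a ν ∂μ := by
    simp_rw [Finset.smul_sum, smul_smul]
    rw [integral_finsetSum]
    · refine Finset.sum_congr rfl fun ν _ => ?_
      rw [← integral_const_mul, ← integral_smul_const]
      congr 1; ext t; congr 1; ring
    · intro ν _
      refine Integrable.smul_const ?_ _
      refine ((hi ν).const_mul (c ν)).congr (Filter.Eventually.of_forall fun t => ?_)
      simp only; ring
  rw [h1, ← integral_mul_const]
  refine norm_integral_le_of_norm_le (hψ.norm.mul_const _) (Filter.Eventually.of_forall fun t => ?_)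
  rw [norm_smul]
  exact mul_le_mul_of_nonneg_left (h c t) (norm_nonneg _)

theorem FlowBounded.norm_sum_filterFreq_le (h : FlowBounded S a) {σ : ℝ} (hσ : 0 < σ) (c : ℝ → ℂ) (u : ℝ) :
    ‖∑ ν ∈ S, (c ν * filterFreq σ (u - ν)) • a ν‖ ≤ 1 / √(σ * √(2 * Real.pi)) * ‖∑ ν ∈ S, c ν • a ν‖ := by
  have hp : (0 : ℝ) < √(2 * Real.pi) := by positivity
  have hn : ∀ t : ℝ, ‖Complex.exp (Complex.I * (-u : ℝ) * t) * (filterTime σ t : ℂ)‖ = filterTime σ t := fun t => by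
    rw [norm_mul, norm_cexp_I_mul_mul, one_mul, Complex.norm_real, Real.norm_of_nonneg (filterTime_nonneg _ _)]
  have h1 := h.norm_sum_integral_le (μ := volume)
    (ψ := fun t => Complex.exp (Complex.I * (-u : ℝ) * t) * (filterTime σ t : ℂ)) (by
      refine (integrable_filterTime hσ).ofReal.bdd_mul (c := 1) ?_ ?_
      · exact (by fun_prop : Continuous fun t : ℝ => Complex.exp (Complex.I * (-u : ℝ) * t)).aestronglyMeasurable
      · exact Filter.Eventually.of_forall fun t => (norm_cexp_I_mul_mul _ t).le) c
  simp_rw [hn] at h1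
  rw [integral_filterTime hσ] at h1
  have h2 : ∀ ν : ℝ, ∫ t : ℝ, Complex.exp (Complex.I * ν * t) *
      (Complex.exp (Complex.I * (-u : ℝ) * t) * (filterTime σ t : ℂ)) = √(2 * Real.pi) * filterFreq σ (u - ν) := fun ν => by
    rw [← filterFreq_neg, ← integral_cexp_mul_filterTime hσ]
    congr 1; ext t
    rw [← mul_assoc, ← Complex.exp_add]
    congr 2; push_cast; ring
  simp_rw [h2] at h1
  have h3 : ∑ ν ∈ S, (c ν * (√(2 * Real.pi) * filterFreq σ (u - ν))) • a ν =
      (√(2 * Real.pi) : ℂ) • ∑ ν ∈ S, (c ν * filterFreq σ (u - ν)) • a ν := by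
    rw [Finset.smul_sum]
    refine Finset.sum_congr rfl fun ν _ => ?_
    rw [smul_smul]; congr 1; ring
  rw [h3, norm_smul, Complex.norm_real, Real.norm_of_nonneg hp.le] at h1
  refine le_of_mul_le_mul_left (h1.trans_eq ?_) hp
  ring

theorem FlowBounded.norm_sum_avgCoeff_le (h : FlowBounded S a) {τ : ℝ} (hτ : 0 < τ) (c : ℝ → ℂ) :
    ‖∑ ν ∈ S, (c ν * avgCoeff τ ν) • a ν‖ ≤ ‖∑ ν ∈ S, c ν • a ν‖ := by
  have h1 := h.norm_sum_integral_le (μ := volume.restrict (Set.Icc (-τ) τ))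
    (ψ := fun _ => ((1 / (2 * τ) : ℝ) : ℂ)) (Continuous.integrableOn_Icc continuous_const) c
  simp_rw [integral_mul_const, mul_comm _ ((1 / (2 * τ) : ℝ) : ℂ)] at h1
  refine h1.trans_eq ?_
  rw [Complex.norm_real, Real.norm_of_nonneg (by positivity), integral_const]
  simp only [MeasurableSet.univ, measureReal_restrict_apply, Set.univ_inter, Real.volume_real_Icc, smul_eq_mul]
  rw [max_eq_left (by linarith)]
  have : (τ - -τ) * (1 / (2 * τ)) = 1 := by field_simp; ring
  rw [this, one_mul]

theorem filterFreq_eq_exp_mul {σ : ℝ} (hσ : 0 < σ) (b u ν : ℝ) :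
    filterFreq σ (u - ν) = Real.exp (σ ^ 2 * b ^ 2) * Real.exp (-(b * u)) * (Real.exp (b * ν) *
      filterFreq σ (u - 2 * σ ^ 2 * b - ν)) := by
  rw [sub_right_comm, filterFreq_sub hσ]
  have : Real.exp (σ ^ 2 * b ^ 2) * Real.exp (-(b * u)) * Real.exp (b * ν) *
      Real.exp (b * (u - ν) - σ ^ 2 * b ^ 2) = 1 := by
    rw [← Real.exp_add, ← Real.exp_add, ← Real.exp_add, Real.exp_eq_one_iff]; ring
  linear_combination -filterFreq σ (u - ν) * this

/-- Filtering at `u` equals, up to `e^{σ²b²-bu}`, filtering the imaginary-time evolved family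
`e^{bν} a_ν` at a shifted frequency. Taking `b = ±β₀` according to the sign of `u` gives decay in
`|u|`. -/
theorem FlowBounded.norm_sum_filterFreq_le_exp (h : FlowBounded S a) {σ : ℝ} (hσ : 0 < σ) (b u : ℝ) :
    ‖∑ ν ∈ S, (filterFreq σ (u - ν) : ℂ) • a ν‖ ≤
      Real.exp (σ ^ 2 * b ^ 2) / √(σ * √(2 * Real.pi)) * Real.exp (-(b * u)) *
        ‖∑ ν ∈ S, (Real.exp (b * ν) : ℂ) • a ν‖ := by
  have h1 : ∑ ν ∈ S, (filterFreq σ (u - ν) : ℂ) • a ν =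
      ((Real.exp (σ ^ 2 * b ^ 2) * Real.exp (-(b * u)) : ℝ) : ℂ) •
      ∑ ν ∈ S, ((Real.exp (b * ν) : ℂ) * filterFreq σ (u - 2 * σ ^ 2 * b - ν)) • a ν := by
    rw [Finset.smul_sum]
    refine Finset.sum_congr rfl fun ν _ => ?_
    rw [smul_smul, filterFreq_eq_exp_mul hσ b, Complex.ofReal_mul, Complex.ofReal_mul (Real.exp (b * ν))]
  rw [h1, norm_smul, Complex.norm_real, Real.norm_of_nonneg (by positivity)]
  calc _ ≤ Real.exp (σ ^ 2 * b ^ 2) * Real.exp (-(b * u)) * _ :=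
        mul_le_mul_of_nonneg_left (h.norm_sum_filterFreq_le hσ _ _) (by positivity)
    _ = _ := by ring

theorem integrableOn_and_integral_exp_neg_abs {b Ω : ℝ} (hb : 0 < b) (hΩ : 0 ≤ Ω) :
    IntegrableOn (fun u => Real.exp (-(b * |u|))) (Set.Icc (-Ω) Ω)ᶜ ∧
      ∫ u in (Set.Icc (-Ω) Ω)ᶜ, Real.exp (-(b * |u|)) = 2 * Real.exp (-(b * Ω)) / b := by
  have hset : (Set.Icc (-Ω) Ω)ᶜ = Set.Iio (-Ω) ∪ Set.Ioi Ω := by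
    ext x; simp only [Set.mem_compl_iff, Set.mem_Icc, not_and_or, not_le, Set.mem_union, Set.mem_Iio, Set.mem_Ioi]
  have e1 : Set.EqOn (fun u => Real.exp (-(b * |u|))) (fun u => Real.exp (-b * u)) (Set.Ioi Ω) := fun u hu => by
    simp only [abs_of_pos (hΩ.trans_lt hu), neg_mul]
  have e2 : Set.EqOn (fun u => Real.exp (-(b * |u|))) (fun u => Real.exp (b * u)) (Set.Iio (-Ω)) := fun u hu => by
    have : u < 0 := lt_of_lt_of_le hu (by linarith)
    simp only [abs_of_neg this, mul_neg, neg_neg]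
  have i1 : IntegrableOn (fun u => Real.exp (-(b * |u|))) (Set.Ioi Ω) :=
    (integrableOn_congr_fun e1 measurableSet_Ioi).2 (integrableOn_exp_mul_Ioi (by linarith) Ω)
  have i2 : IntegrableOn (fun u => Real.exp (-(b * |u|))) (Set.Iio (-Ω)) :=
    (integrableOn_congr_fun e2 measurableSet_Iio).2
      ((integrableOn_exp_mul_Iic hb (-Ω)).mono_set Set.Iio_subset_Iic_self)
  rw [hset]
  refine ⟨i2.union i1, ?_⟩
  have hdisj : Disjoint (Set.Iio (-Ω)) (Set.Ioi Ω) :=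
    Set.disjoint_left.2 fun x (h1 : x < -Ω) (h2 : Ω < x) => by linarith
  rw [setIntegral_union hdisj measurableSet_Ioi i2 i1, setIntegral_congr_fun measurableSet_Ioi e1,
    setIntegral_congr_fun measurableSet_Iio e2, ← integral_Iic_eq_integral_Iio,
    integral_exp_mul_Ioi (by linarith), integral_exp_mul_Iic hb]
  field_simp
  ring

theorem FlowBounded.norm_sum_high_le (h : FlowBounded S a) {σ β₀ Ω : ℝ} (hσ : 0 < σ) (hβ₀ : 0 < β₀) (hΩ : 0 ≤ Ω) :
    ‖∑ ν ∈ S, (((√2 * √(σ * √(2 * Real.pi)) - lowCoeff σ Ω ν : ℝ)) : ℂ) • a ν‖ ≤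
      Real.exp (σ ^ 2 * β₀ ^ 2) / √(σ * √(2 * Real.pi)) * (2 * Real.exp (-(β₀ * Ω)) / β₀) *
        (‖∑ ν ∈ S, (Real.exp (-(β₀ * ν)) : ℂ) • a ν‖ + ‖∑ ν ∈ S, (Real.exp (β₀ * ν) : ℂ) • a ν‖) := by
  have hi : ∀ ν, Integrable fun u => filterFreq σ (u - ν) := fun ν => (integrable_filterFreq hσ).comp_sub_right ν
  have hiC : ∀ ν, Integrable fun u => (filterFreq σ (u - ν) : ℂ) := fun ν => (hi ν).ofReal
  -- The constant is the full integral of `f̂`, so the difference is its part over `|u| > Ω`.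
  have h1 : ∀ ν, ((√2 * √(σ * √(2 * Real.pi)) - lowCoeff σ Ω ν : ℝ) : ℂ) =
      ∫ u in (Set.Icc (-Ω) Ω)ᶜ, (filterFreq σ (u - ν) : ℂ) := fun ν => by
    rw [integral_complex_ofReal, setIntegral_compl measurableSet_Icc (hi ν), integral_sub_right_eq_self,
      integral_filterFreq hσ, lowCoeff]
  simp_rw [h1, ← integral_smul_const]
  rw [← integral_finsetSum _ fun ν _ => ((hiC ν).smul_const (a ν)).integrableOn]
  obtain ⟨h2, h3⟩ := integrableOn_and_integral_exp_neg_abs hβ₀ hΩ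
  rw [← h3, ← integral_const_mul, ← integral_mul_const]
  refine norm_integral_le_of_norm_le ((h2.const_mul _).mul_const _) (Filter.Eventually.of_forall fun u => ?_)
  rcases abs_cases u with ⟨hu, _⟩ | ⟨hu, _⟩ <;> rw [hu]
  · refine (h.norm_sum_filterFreq_le_exp hσ β₀ u).trans ?_
    refine mul_le_mul_of_nonneg_left ?_ (by positivity)
    linarith [norm_nonneg (∑ ν ∈ S, (Real.exp (-(β₀ * ν)) : ℂ) • a ν)]
  · refine (h.norm_sum_filterFreq_le_exp hσ (-β₀) u).trans ?_
    rw [neg_sq, neg_mul, ← mul_neg]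
    refine mul_le_mul_of_nonneg_left ?_ (by positivity)
    simp only [neg_mul]
    linarith [norm_nonneg (∑ ν ∈ S, (Real.exp (β₀ * ν) : ℂ) • a ν)]

/-- The second derivative of the flow has norm at most that of `∑ ν² a_ν`. Two mean value estimates
bound the first-order Taylor remainder, and the linear term averages to zero over the symmetric
window, so the error is quadratic in `τ`. -/
theorem FlowBounded.norm_sum_one_sub_avgCoeff_le (h : FlowBounded S a) {τ : ℝ} (hτ : 0 < τ) :
    ‖∑ ν ∈ S, (1 - avgCoeff τ ν) • a ν‖ ≤ τ ^ 2 * ‖∑ ν ∈ S, ((ν : ℂ) ^ 2) • a ν‖ := by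
  set M := ‖∑ ν ∈ S, ((ν : ℂ) ^ 2) • a ν‖ with hM
  have h0 : (0 : ℝ) ∈ Set.Icc (-τ) τ := ⟨by linarith, hτ.le⟩
  have hexp : ∀ ν t : ℝ, HasDerivAt (fun t : ℝ => Complex.exp (Complex.I * ν * t))
      (Complex.I * ν * Complex.exp (Complex.I * ν * t)) t := fun ν t => by
    have := ((Complex.ofRealCLM.hasDerivAt (x := t)).const_mul (Complex.I * ν)).cexp
    simpa [mul_comm] using this
  have d1 : ∀ t ∈ Set.Icc (-τ) τ, ‖∑ ν ∈ S, (Complex.I * ν * (Complex.exp (Complex.I * ν * t) - 1)) • a ν‖ ≤ τ * M := by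
    intro t ht
    have hd : ∀ s ∈ Set.Icc (-τ) τ, HasDerivWithinAt
        (fun s : ℝ => ∑ ν ∈ S, (Complex.I * ν * (Complex.exp (Complex.I * ν * s) - 1)) • a ν)
        (∑ ν ∈ S, (Complex.I * ν * (Complex.I * ν * Complex.exp (Complex.I * ν * s))) • a ν)
        (Set.Icc (-τ) τ) s := fun s _ => by
      refine HasDerivWithinAt.fun_sum fun ν _ => ?_
      exact ((((hexp ν s).sub_const 1).const_mul _).smul_const _).hasDerivWithinAt
    have hb : ∀ s ∈ Set.Icc (-τ) τ,
        ‖∑ ν ∈ S, (Complex.I * ν * (Complex.I * ν * Complex.exp (Complex.I * ν * s))) • a ν‖ ≤ M := fun s _ => by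
      have := h (fun ν => (ν : ℂ) ^ 2) s
      rw [← norm_neg, ← Finset.sum_neg_distrib]
      refine le_trans (le_of_eq ?_) this
      congr 1
      refine Finset.sum_congr rfl fun ν _ => ?_
      rw [← neg_smul]
      congr 1
      linear_combination -(ν : ℂ) ^ 2 * Complex.exp (Complex.I * ν * s) * Complex.I_sq
    have := (convex_Icc (-τ) τ).norm_image_sub_le_of_norm_hasDerivWithin_le hd hb h0 ht
    simp only [Complex.ofReal_zero, mul_zero, Complex.exp_zero, sub_self, zero_smul, Finset.sum_const_zero,
      sub_zero] at this
    refine this.trans ?_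
    rw [mul_comm]
    exact mul_le_mul_of_nonneg_right (abs_le.2 ht) (norm_nonneg _)
  have d2 : ∀ t ∈ Set.Icc (-τ) τ, ‖∑ ν ∈ S, (1 + Complex.I * ν * t - Complex.exp (Complex.I * ν * t)) • a ν‖ ≤ τ ^ 2 * M := by
    intro t ht
    have hd : ∀ s ∈ Set.Icc (-τ) τ, HasDerivWithinAt
        (fun s : ℝ => ∑ ν ∈ S, (Complex.exp (Complex.I * ν * s) - 1 - Complex.I * ν * s) • a ν)
        (∑ ν ∈ S, (Complex.I * ν * (Complex.exp (Complex.I * ν * s) - 1)) • a ν)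
        (Set.Icc (-τ) τ) s := fun s _ => by
      refine HasDerivWithinAt.fun_sum fun ν _ => ?_
      have hl : HasDerivAt (fun s : ℝ => Complex.I * ν * s) (Complex.I * ν) s := by
        simpa using (Complex.ofRealCLM.hasDerivAt (x := s)).const_mul (Complex.I * ν)
      have := ((((hexp ν s).sub_const 1).sub hl).smul_const (a ν)).hasDerivWithinAt (s := Set.Icc (-τ) τ)
      rw [mul_sub, mul_one]
      exact this
    have := (convex_Icc (-τ) τ).norm_image_sub_le_of_norm_hasDerivWithin_le hd d1 h0 ht
    simp only [Complex.ofReal_zero, mul_zero, Complex.exp_zero, sub_self, zero_smul, Finset.sum_const_zero,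
      sub_zero] at this
    have e : ∑ ν ∈ S, (1 + Complex.I * ν * t - Complex.exp (Complex.I * ν * t)) • a ν =
        -∑ ν ∈ S, (Complex.exp (Complex.I * ν * t) - 1 - Complex.I * ν * t) • a ν := by
      rw [← Finset.sum_neg_distrib]
      refine Finset.sum_congr rfl fun ν _ => ?_
      rw [← neg_smul]; congr 1; ring
    rw [e, norm_neg]
    refine this.trans ?_
    have h3 : |t| ≤ τ := abs_le.2 ht
    rw [Real.norm_eq_abs]
    have : 0 ≤ τ * M := mul_nonneg hτ.le (norm_nonneg _)
    nlinarith
  have hτC : (τ : ℂ) ≠ 0 := by exact_mod_cast hτ.ne'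
  have e1 : ∀ ν : ℝ, (1 - avgCoeff τ ν) = ((1 / (2 * τ) : ℝ) : ℂ) *
      ∫ t in Set.Icc (-τ) τ, (1 + Complex.I * ν * t - Complex.exp (Complex.I * ν * t)) := fun ν => by
    have hodd : ∫ t in Set.Icc (-τ) τ, (t : ℂ) = 0 := by
      rw [integral_complex_ofReal, integral_Icc_eq_integral_Ioc, ← intervalIntegral.integral_of_le (by linarith),
        integral_id]
      simp
    rw [integral_sub (Continuous.integrableOn_Icc (by fun_prop)) (Continuous.integrableOn_Icc (by fun_prop)),
      integral_add (Continuous.integrableOn_Icc (by fun_prop)) (Continuous.integrableOn_Icc (by fun_prop)),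
      integral_const_mul, hodd, avgCoeff, integral_const]
    simp only [MeasurableSet.univ, measureReal_restrict_apply, Set.univ_inter, Real.volume_real_Icc]
    rw [max_eq_left (by linarith), Complex.real_smul]
    push_cast
    field_simp
    ring
  have e2 : ∑ ν ∈ S, (1 - avgCoeff τ ν) • a ν = ((1 / (2 * τ) : ℝ) : ℂ) •
      ∫ t in Set.Icc (-τ) τ, ∑ ν ∈ S, (1 + Complex.I * ν * t - Complex.exp (Complex.I * ν * t)) • a ν := by
    rw [integral_finsetSum _ fun ν _ => Continuous.integrableOn_Icc (by fun_prop), Finset.smul_sum]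
    refine Finset.sum_congr rfl fun ν _ => ?_
    rw [e1, integral_smul_const, smul_smul]
  rw [e2, norm_smul, Complex.norm_real, Real.norm_of_nonneg (by positivity)]
  have h4 := norm_setIntegral_le_of_norm_le_const (μ := volume) (s := Set.Icc (-τ) τ)
    (by simp) d2
  rw [Real.volume_real_Icc, max_eq_left (by linarith)] at h4
  calc _ ≤ 1 / (2 * τ) * (τ ^ 2 * M * (τ - -τ)) := mul_le_mul_of_nonneg_left h4 (by positivity)
    _ = _ := by field_simp; ring

end Flow

/-! ### The Heisenberg flow is contractive. -/

section FlowMatrix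

variable {m : Type*} [Fintype m] [DecidableEq m] {H : Matrix m m ℂ} (hH : H.IsHermitian)

theorem norm_exp_I_smul_le (hH : H.IsHermitian) (t : ℝ) : ‖exp ((Complex.I * t) • H)‖ ≤ 1 := by
  have h1 : (exp ((Complex.I * t) • H)).conjTranspose = exp (-(Complex.I * t) • H) := by
    rw [← Matrix.exp_conjTranspose, Matrix.conjTranspose_smul, hH.eq]
    simp
  have h2 := Matrix.l2_opNorm_conjTranspose_mul_self (exp ((Complex.I * t) • H))
  rw [h1, exp_smul_mul_exp_smul, neg_add_cancel, zero_smul, exp_zero] at h2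
  have h3 : ‖(1 : Matrix m m ℂ)‖ ≤ 1 := by
    cases isEmpty_or_nonempty m
    · rw [Subsingleton.elim (1 : Matrix m m ℂ) 0, norm_zero]; exact zero_le_one
    · exact (CStarRing.norm_one).le
  nlinarith

theorem flowBounded_bohrComponent (A : Matrix m m ℂ) : FlowBounded (bohrFreqs hH) (bohrComponent hH A) := by
  intro c t
  have h1 : ∑ ν ∈ bohrFreqs hH, (c ν * Complex.exp (Complex.I * ν * t)) • bohrComponent hH A ν =
      exp ((Complex.I * t) • H) * (∑ ν ∈ bohrFreqs hH, c ν • bohrComponent hH A ν) * exp (-(Complex.I * t) • H) := by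
    rw [Finset.mul_sum, Finset.sum_mul]
    refine Finset.sum_congr rfl fun ν _ => ?_
    rw [Matrix.mul_smul, Matrix.smul_mul, exp_conj_bohrComponent, smul_smul, mul_right_comm]
  have h2 := norm_exp_I_smul_le hH t
  have h3 := norm_exp_I_smul_le hH (-t)
  rw [Complex.ofReal_neg, mul_neg] at h3
  rw [h1]
  refine (norm_mul_le _ _).trans ((mul_le_of_le_one_right (norm_nonneg _) h3).trans ?_)
  exact (norm_mul_le _ _).trans (mul_le_of_le_one_left (norm_nonneg _) h2)

theorem sum_sq_smul_bohrComponent (A : Matrix m m ℂ) :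
    ∑ ν ∈ bohrFreqs hH, ((ν : ℂ) ^ 2) • bohrComponent hH A ν =
      H * (H * A - A * H) - (H * A - A * H) * H := by
  have h1 : H * A - A * H = ∑ ν ∈ bohrFreqs hH, (ν : ℂ) • bohrComponent hH A ν := by
    conv_lhs => rw [← sum_bohrComponent hH A]
    rw [Finset.mul_sum, Finset.sum_mul, ← Finset.sum_sub_distrib]
    exact Finset.sum_congr rfl fun ν _ => commutator_bohrComponent hH A ν
  rw [h1, Finset.mul_sum, Finset.sum_mul, ← Finset.sum_sub_distrib]
  refine Finset.sum_congr rfl fun ν _ => ?_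
  rw [Matrix.mul_smul, Matrix.smul_mul, ← smul_sub, commutator_bohrComponent, smul_smul, sq]

end FlowMatrix

/-! ### Supports, commutation and the double commutator with the Hamiltonian. -/

section Locality

theorem apply_piecewise_of_actsTriviallyAt {Λ : Type*} [DecidableEq Λ] {A : QubitOp Λ}
    (T : Finset Λ) (u x y : Λ → Fin 2)
    (hA : ∀ i ∈ T, ActsTriviallyAt A i) (hxy : ∀ i ∈ T, x i = y i) :
    A (T.piecewise u x) (T.piecewise u y) = A x y := by
  induction T using Finset.induction_on with
  | empty => simp
  | insert i T hi ih =>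
    rw [Finset.piecewise_insert, Finset.piecewise_insert,
      (hA i (Finset.mem_insert_self i T)).2 _ _ _ (by
        rw [Finset.piecewise_eq_of_notMem _ _ _ hi, Finset.piecewise_eq_of_notMem _ _ _ hi]
        exact hxy i (Finset.mem_insert_self i T))]
    exact ih (fun j hj => hA j (Finset.mem_insert_of_mem hj))
      (fun j hj => hxy j (Finset.mem_insert_of_mem hj))

variable {Λ : Type*} [Fintype Λ] [DecidableEq Λ]

theorem notMem_opSupport {A : QubitOp Λ} {i : Λ} : i ∉ opSupport A ↔ ActsTriviallyAt A i := by
  simp [opSupport]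

/-- Operators with disjoint supports commute. -/
theorem commute_of_disjoint_opSupport {A B : QubitOp Λ} (h : opSupport A ∩ opSupport B = ∅) : Commute A B := by
  set S := opSupport A with hS
  have hA : ∀ i ∉ S, ActsTriviallyAt A i := fun i hi => notMem_opSupport.1 hi
  have hB : ∀ i ∈ S, ActsTriviallyAt B i := fun i hi => notMem_opSupport.1 fun hi' => by
    have := Finset.mem_inter.2 ⟨hi, hi'⟩
    rw [h] at this
    simp at this
  have hne : ∀ {w z : Λ → Fin 2}, w ≠ z → ∃ i, w i ≠ z i := fun h => Function.ne_iff.1 h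
  ext x y
  -- One intermediate configuration survives: `A` forces agreement with `x` off `S`, and `B` forces
  -- agreement with `y` on `S`.
  have h1 : (A * B) x y = A x (S.piecewise y x) * B (S.piecewise y x) y := by
    rw [Matrix.mul_apply]
    refine Finset.sum_eq_single _ (fun w _ hw => ?_) (by simp)
    obtain ⟨i, hi⟩ := hne hw
    by_cases hiS : i ∈ S
    · rw [Finset.piecewise_eq_of_mem _ _ _ hiS] at hi
      rw [(hB i hiS).1 _ _ hi, mul_zero]
    · rw [Finset.piecewise_eq_of_notMem _ _ _ hiS] at hi
      rw [(hA i hiS).1 _ _ hi.symm, zero_mul]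
  have h2 : (B * A) x y = B x (S.piecewise x y) * A (S.piecewise x y) y := by
    rw [Matrix.mul_apply]
    refine Finset.sum_eq_single _ (fun w _ hw => ?_) (by simp)
    obtain ⟨i, hi⟩ := hne hw
    by_cases hiS : i ∈ S
    · rw [Finset.piecewise_eq_of_mem _ _ _ hiS] at hi
      rw [(hB i hiS).1 _ _ hi.symm, zero_mul]
    · rw [Finset.piecewise_eq_of_notMem _ _ _ hiS] at hi
      rw [(hA i hiS).1 _ _ hi, mul_zero]
  have h3 : A x (S.piecewise y x) = A (S.piecewise x y) y := by
    rw [← apply_piecewise_of_actsTriviallyAt (A := A) Sᶜ y x (S.piecewise y x)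
      (fun i hi => hA i (Finset.mem_compl.1 hi))
      (fun i hi => (Finset.piecewise_eq_of_notMem _ _ _ (Finset.mem_compl.1 hi)).symm)]
    congr 1
    · rw [Finset.piecewise_compl]
    · rw [Finset.piecewise_compl]
      ext i
      by_cases hiS : i ∈ S <;> simp [hiS]
  have h4 : B (S.piecewise y x) y = B x (S.piecewise x y) := by
    rw [← apply_piecewise_of_actsTriviallyAt (A := B) S x (S.piecewise y x) y hB
      (fun i hi => Finset.piecewise_eq_of_mem _ _ _ hi)]
    congr 1
    ext i
    by_cases hiS : i ∈ S <;> simp [hiS]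
  rw [h1, h2, h3, h4, mul_comm]

namespace LocalHamiltonian

variable {Γ : Type*} [Fintype Γ] (h : LocalHamiltonian Λ Γ)

open scoped Classical in
/-- The terms whose support intersects the support of `A`. -/
def overlapping (A : QubitOp Λ) : Finset Γ :=
  Finset.univ.filter fun γ => (opSupport A ∩ opSupport (h.term γ)).Nonempty

theorem commute_of_notMem_overlapping {A : QubitOp Λ} {γ : Γ} (hγ : γ ∉ h.overlapping A) :
    Commute A (h.term γ) := by
  refine commute_of_disjoint_opSupport (Finset.not_nonempty_iff_eq_empty.1 fun hne => hγ ?_)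
  simpa [overlapping] using hne

theorem card_overlapping_term_le (γ : Γ) : (h.overlapping (h.term γ)).card ≤ h.interactionDegree := by
  unfold interactionDegree overlapping
  refine le_trans (le_of_eq ?_) (Finset.le_sup (f := fun γ : Γ => (Finset.univ.filter fun γ' : Γ =>
      (opSupport (h.term γ) ∩ opSupport (h.term γ')).Nonempty).card) (Finset.mem_univ γ))
  congr

/-- All terms containing a given qubit overlap each other, so any one of them has the whole group
among its neighbours; counting its self-loop, the group has at most `interactionDegree` members. -/
theorem card_overlapping_le (A : QubitOp Λ) :
    (h.overlapping A).card ≤ (opSupport A).card * h.interactionDegree := by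
  classical
  have h1 : h.overlapping A ⊆ (opSupport A).biUnion fun i => Finset.univ.filter fun γ => i ∈ opSupport (h.term γ) := by
    intro γ hγ
    obtain ⟨i, hi⟩ := (Finset.mem_filter.1 hγ).2
    rw [Finset.mem_inter] at hi
    exact Finset.mem_biUnion.2 ⟨i, hi.1, Finset.mem_filter.2 ⟨Finset.mem_univ _, hi.2⟩⟩
  refine (Finset.card_le_card h1).trans (Finset.card_biUnion_le_card_mul _ _ _ fun i _ => ?_)
  rcases (Finset.univ.filter fun γ => i ∈ opSupport (h.term γ)).eq_empty_or_nonempty with he | ⟨γ, hγ⟩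
  · rw [he]; simp
  · refine le_trans (Finset.card_le_card fun γ' hγ' => ?_) (h.card_overlapping_term_le γ)
    exact Finset.mem_filter.2 ⟨Finset.mem_univ _, i, Finset.mem_inter.2
      ⟨(Finset.mem_filter.1 hγ).2, (Finset.mem_filter.1 hγ').2⟩⟩

theorem norm_commutator_le {m : Type*} [Fintype m] [DecidableEq m] {X Y : Matrix m m ℂ} (hX : ‖X‖ ≤ 1) :
    ‖X * Y - Y * X‖ ≤ 2 * ‖Y‖ := by
  have h1 := norm_mul_le X Y
  have h2 := norm_mul_le Y X
  have h3 := norm_sub_le (X * Y) (Y * X)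
  nlinarith [norm_nonneg Y]

theorem commutator_total_eq_sum {s : Finset Γ} {Y : QubitOp Λ} (hs : ∀ γ ∉ s, Commute Y (h.term γ)) :
    h.total * Y - Y * h.total = ∑ γ ∈ s, (h.term γ * Y - Y * h.term γ) := by
  rw [total, Finset.sum_mul, Finset.mul_sum, ← Finset.sum_sub_distrib]
  refine (Finset.sum_subset (Finset.subset_univ s) fun γ _ hγ => ?_).symm
  rw [(hs γ hγ).eq, sub_self]

/-- With `n = |A|`, at most `nd` terms `H_γ` meet `A`, and for each at most `nd + d ≤ 2nd` terms
meet `A` or `H_γ`. Each double commutator has norm at most 4, so the total is at most `8(nd)²`. -/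
theorem norm_double_commutator_le {d : ℕ} (hd0 : 1 ≤ d) (hd : h.interactionDegree ≤ d) {A : QubitOp Λ} (hA : ‖A‖ ≤ 1)
    (hcard : 1 ≤ (opSupport A).card) :
    ‖h.total * (h.total * A - A * h.total) - (h.total * A - A * h.total) * h.total‖ ≤
      8 * ((d : ℝ) ^ 2 * (opSupport A).card) ^ 2 := by
  classical
  set n := (opSupport A).card
  have hsum : h.total * (h.total * A - A * h.total) - (h.total * A - A * h.total) * h.total =
      ∑ γ ∈ h.overlapping A, (h.total * (h.term γ * A - A * h.term γ) - (h.term γ * A - A * h.term γ) * h.total) := by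
    rw [h.commutator_total_eq_sum fun γ => h.commute_of_notMem_overlapping (A := A), Finset.mul_sum, Finset.sum_mul,
      ← Finset.sum_sub_distrib]
  have hterm : ∀ γ, ‖h.total * (h.term γ * A - A * h.term γ) - (h.term γ * A - A * h.term γ) * h.total‖ ≤
      (n * d + d : ℕ) * 4 := fun γ => by
    rw [h.commutator_total_eq_sum (s := h.overlapping A ∪ h.overlapping (h.term γ)) fun γ' hγ' => by
      rw [Finset.mem_union, not_or] at hγ'
      have c1 := h.commute_of_notMem_overlapping hγ'.1
      have c2 := h.commute_of_notMem_overlapping hγ'.2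
      exact (c2.mul_left c1).sub_left (c1.mul_left c2)]
    refine (norm_sum_le_of_le (f := fun γ' => h.term γ' * (h.term γ * A - A * h.term γ) -
      (h.term γ * A - A * h.term γ) * h.term γ') (n := fun _ => (4 : ℝ)) _ fun γ' _ => ?_).trans ?_
    · have h1 := norm_commutator_le (Y := A) (h.norm_term_le_one γ)
      have h2 := norm_commutator_le (Y := h.term γ * A - A * h.term γ) (h.norm_term_le_one γ')
      linarith
    · rw [Finset.sum_const, nsmul_eq_mul]
      refine mul_le_mul_of_nonneg_right (Nat.cast_le.2 ?_) (by norm_num)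
      refine (Finset.card_union_le _ _).trans (add_le_add ?_ ((h.card_overlapping_term_le γ).trans hd))
      exact (h.card_overlapping_le A).trans (Nat.mul_le_mul_left _ hd)
  rw [hsum]
  refine (norm_sum_le_of_le _ fun γ _ => hterm γ).trans ?_
  rw [Finset.sum_const, nsmul_eq_mul]
  have hc : ((h.overlapping A).card : ℝ) ≤ n * d := by
    exact_mod_cast (h.card_overlapping_le A).trans (Nat.mul_le_mul_left _ hd)
  have hn1 : (1 : ℝ) ≤ n := by exact_mod_cast hcard
  have hd1 : (1 : ℝ) ≤ d := by exact_mod_cast hd0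
  push_cast
  calc ((h.overlapping A).card : ℝ) * ((n * d + d) * 4) ≤ (n * d) * ((n * d + n * d) * 4) := by
        gcongr
        nlinarith
    _ = 8 * ((d : ℝ) ^ 1 * n) ^ 2 := by ring
    _ ≤ _ := by gcongr; norm_num

end LocalHamiltonian

end Locality

/-! ### The three-term estimate with free cutoffs `τ` and `Ω`. -/

section Combination

variable {m : Type*} [Fintype m] [DecidableEq m] [Nonempty m] {H : Matrix m m ℂ} (hH : H.IsHermitian)

/-- The Dirichlet form is real and nonnegative. -/
theorem dirichletForm_self_nonneg {β σ : ℝ} (hβ : 0 < β) (hσ : 0 < σ) {A : Matrix m m ℂ} (hA : A.IsHermitian)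
    (O : Matrix m m ℂ) : 0 ≤ dirichletForm hH β σ A O O := by
  rw [dirichletForm_eq_sum hH hβ hσ hA, ← (integrable_exp_mul_energyDensity hβ hσ (bohrFreqs hH)
    fun ν => commEmbed H β O (bohrComponent hH A ν)).2, Complex.zero_le_real]
  refine mul_nonneg (Real.exp_pos _).le (MeasureTheory.integral_nonneg fun u => ?_)
  exact mul_nonneg (Real.exp_pos _).le (energyDensity_nonneg hβ _ _ _ _)

theorem kmsNorm_commutator_le {β β₀ σ τ Ω : ℝ} (hβ : 0 < β) (hβ₀ : 0 < β₀) (hσ : 0 < σ) (hτ : 0 < τ) (hτ1 : τ ≤ 1)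
    (hΩ : 0 ≤ Ω) {A O : Matrix m m ℂ} (hA : A.IsHermitian) (hO : ‖O‖ ≤ 1) :
    kmsNorm (gibbs H β) (A * O - O * A) ≤
      2 * (τ ^ 2 * ‖H * (H * A - A * H) - (H * A - A * H) * H‖) +
      2 * (Real.exp (σ ^ 2 * β₀ ^ 2) / (β₀ * σ)) * Real.exp (-(β₀ * Ω)) *
        (‖gibbs H β₀ * A * (gibbs H β₀)⁻¹‖ + ‖(gibbs H β₀)⁻¹ * A * gibbs H β₀‖) +
      Real.exp (σ ^ 2 * β ^ 2 / 16) / √(gKernel β 1 * β * σ) * Real.exp (β * Ω / 4) *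
        √(dirichletForm hH β σ A O O).re / √τ := by
  set a := bohrComponent hH A with ha
  set S := bohrFreqs hH with hS
  set Ψ := commEmbed H β O with hΨ
  set E := (dirichletForm hH β σ A O O).re with hEdef
  have hE0 : 0 ≤ dirichletForm hH β σ A O O := dirichletForm_self_nonneg hH hβ hσ hA O
  have hEnn : 0 ≤ E := (Complex.le_def.1 hE0).1
  have hE : ∑ ν₁ ∈ S, ∑ ν₂ ∈ S, (dirichletWeight β σ ν₁ ν₂ : ℂ) * inner ℂ (Ψ (a ν₁)) (Ψ (a ν₂)) = E := by
    rw [← dirichletForm_eq_sum hH hβ hσ hA]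
    apply Complex.ext
    · simp [hEdef]
    · simpa using (Complex.le_def.1 hE0).2.symm
  have hflow : FlowBounded S a := flowBounded_bohrComponent hH A
  set N := √(σ * √(2 * Real.pi)) with hN
  have hNpos : 0 < N := by positivity
  have hN2 : N ^ 2 = σ * √(2 * Real.pi) := Real.sq_sqrt (by positivity)
  set κ := √2 * N with hκ
  have hκpos : 0 < κ := by positivity
  have hκ2 : κ ^ 2 = 2 * (σ * √(2 * Real.pi)) := by rw [hκ, mul_pow, hN2, Real.sq_sqrt (by norm_num)]
  have hpi : 2 ≤ √(2 * Real.pi) := by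
    refine Real.le_sqrt_of_sq_le ?_
    linarith [Real.pi_gt_three]
  have hΨle := norm_commEmbed_le hH β hO
  -- Time-averaging error, high frequencies, low frequencies. The first two are bounded in operator
  -- norm before the commutator is applied, at the cost of a factor 2; the last directly in the KMS
  -- norm.
  have hsplit : (κ : ℂ) • Ψ A = (κ : ℂ) • Ψ (∑ ν ∈ S, (1 - avgCoeff τ ν) • a ν) +
      Ψ (∑ ν ∈ S, (((κ - lowCoeff σ Ω ν : ℝ) : ℂ) * avgCoeff τ ν) • a ν) +
      ∑ ν ∈ S, ((lowCoeff σ Ω ν : ℂ) * avgCoeff τ ν) • Ψ (a ν) := by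
    have h1 : ∑ ν ∈ S, ((lowCoeff σ Ω ν : ℂ) * avgCoeff τ ν) • Ψ (a ν) =
        Ψ (∑ ν ∈ S, ((lowCoeff σ Ω ν : ℂ) * avgCoeff τ ν) • a ν) := by simp only [map_sum, map_smul]
    rw [h1, ← map_smul, ← map_smul, ← map_add, ← map_add]
    congr 1
    conv_lhs => rw [← sum_bohrComponent hH A]
    rw [Finset.smul_sum, Finset.smul_sum, ← Finset.sum_add_distrib, ← Finset.sum_add_distrib]
    refine Finset.sum_congr rfl fun ν _ => ?_
    push_cast
    module
  have hlow : ‖∑ ν ∈ S, ((lowCoeff σ Ω ν : ℂ) * avgCoeff τ ν) • Ψ (a ν)‖ ≤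
      κ * (Real.exp (σ ^ 2 * β ^ 2 / 16) / √(gKernel β 1 * β * σ) * Real.exp (β * Ω / 4) * √E / √τ) := by
    have hg := gKernel_pos hβ 1
    refine le_of_sq_le_sq ?_ (by positivity)
    refine (norm_sq_low_le hβ hσ hτ hτ1 hΩ S (fun ν => Ψ (a ν)) hE).trans ?_
    rw [mul_pow, hκ2, div_pow, mul_pow, mul_pow, div_pow, Real.sq_sqrt hEnn, Real.sq_sqrt hτ.le,
      Real.sq_sqrt (by positivity), ← Real.exp_nat_mul, ← Real.exp_nat_mul]
    have e1 : ((2 : ℕ) : ℝ) * (σ ^ 2 * β ^ 2 / 16) = β ^ 2 * σ ^ 2 / 8 := by push_cast; ring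
    have e2 : ((2 : ℕ) : ℝ) * (β * Ω / 4) = β * Ω / 2 := by push_cast; ring
    rw [e1, e2]
    have e3 : 4 / β * Real.exp (β * Ω / 2) * (Real.exp (β ^ 2 * σ ^ 2 / 8) * E / (2 * τ * gKernel β 1)) =
        2 * (Real.exp (β * Ω / 2) * Real.exp (β ^ 2 * σ ^ 2 / 8) * E / (β * τ * gKernel β 1)) := by
      field_simp; norm_num
    have e4 : 2 * (σ * √(2 * Real.pi)) * (Real.exp (β ^ 2 * σ ^ 2 / 8) / (gKernel β 1 * β * σ) *
        Real.exp (β * Ω / 2) * E / τ) = 2 * √(2 * Real.pi) *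
        (Real.exp (β * Ω / 2) * Real.exp (β ^ 2 * σ ^ 2 / 8) * E / (β * τ * gKernel β 1)) := by
      field_simp
    rw [e3, e4]
    exact mul_le_mul_of_nonneg_right (by linarith) (by positivity)
  set K := ‖gibbs H β₀ * A * (gibbs H β₀)⁻¹‖ + ‖(gibbs H β₀)⁻¹ * A * gibbs H β₀‖ with hK
  have hhigh : ‖∑ ν ∈ S, (((κ - lowCoeff σ Ω ν : ℝ) : ℂ) * avgCoeff τ ν) • a ν‖ ≤
      κ * (Real.exp (σ ^ 2 * β₀ ^ 2) / (β₀ * σ) * Real.exp (-(β₀ * Ω)) * K) := by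
    refine (hflow.norm_sum_avgCoeff_le hτ _).trans ((hflow.norm_sum_high_le hσ hβ₀ hΩ).trans ?_)
    have e1 : ‖∑ ν ∈ S, (Real.exp (-(β₀ * ν)) : ℂ) • a ν‖ + ‖∑ ν ∈ S, (Real.exp (β₀ * ν) : ℂ) • a ν‖ = K := by
      rw [hK, gibbs_conj hH, gibbs_conj_inv hH]
      push_cast
      simp only [neg_mul]
      rfl
    rw [e1]
    have e2 : Real.exp (σ ^ 2 * β₀ ^ 2) / N * (2 * Real.exp (-(β₀ * Ω)) / β₀) * K =
        (2 / N) * (Real.exp (σ ^ 2 * β₀ ^ 2) * Real.exp (-(β₀ * Ω)) * K / β₀) := by field_simp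
    have e3 : κ * (Real.exp (σ ^ 2 * β₀ ^ 2) / (β₀ * σ) * Real.exp (-(β₀ * Ω)) * K) =
        (κ / σ) * (Real.exp (σ ^ 2 * β₀ ^ 2) * Real.exp (-(β₀ * Ω)) * K / β₀) := by field_simp
    rw [e2, e3]
    refine mul_le_mul_of_nonneg_right ?_ (by positivity)
    rw [div_le_div_iff₀ hNpos hσ, hκ, mul_assoc, ← sq, hN2]
    have h2 : (1 : ℝ) ≤ √2 := Real.one_le_sqrt.2 (by norm_num)
    have h3 : 2 * σ ≤ σ * √(2 * Real.pi) := by nlinarith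
    nlinarith
  have hR := hflow.norm_sum_one_sub_avgCoeff_le hτ
  rw [sum_sq_smul_bohrComponent] at hR
  rw [← norm_kmsEmbed hH, ← commEmbed_apply, ← hΨ]
  refine le_of_mul_le_mul_left ?_ hκpos
  have hnorm : κ * ‖Ψ A‖ = ‖(κ : ℂ) • Ψ A‖ := by
    rw [norm_smul, Complex.norm_real, Real.norm_of_nonneg hκpos.le]
  rw [hnorm, hsplit]
  refine (norm_add₃_le).trans ?_
  rw [norm_smul, Complex.norm_real, Real.norm_of_nonneg hκpos.le, mul_add, mul_add]
  refine add_le_add (add_le_add ?_ ?_) hlow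
  · exact mul_le_mul_of_nonneg_left ((hΨle _).trans (by linarith)) hκpos.le
  · refine (hΨle _).trans ?_
    calc _ ≤ 2 * (κ * (Real.exp (σ ^ 2 * β₀ ^ 2) / (β₀ * σ) * Real.exp (-(β₀ * Ω)) * K)) := by linarith
      _ = _ := by ring

end Combination

/-! ### Choice of the cutoffs. -/

section Optimization

theorem le_of_forall_cutoff_of_pos {φ β β₀ F K E D : ℝ} (hβ : 0 < β) (hβ₀ : 0 < β₀) (hF : 1 ≤ F) (hK : 0 < K)
    (hE : 0 < E) (hD : 1 ≤ D) (h2 : φ ≤ 2) (h2K : φ ≤ 2 * K)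
    (h : ∀ τ Ω : ℝ, 0 < τ → τ ≤ 1 → 0 ≤ Ω →
      φ ≤ 16 * (τ ^ 2 * D ^ 2) + 2 * F * Real.exp (-(β₀ * Ω)) * K + F * Real.exp (β * Ω / 4) * √E / √τ) :
    φ ≤ 19 * D * F ^ ((β + 4 * β₀) / (β + 5 * β₀)) * K ^ (β / (β + 5 * β₀)) *
      E ^ (2 * β₀ / (β + 5 * β₀)) := by
  obtain ⟨f, rfl⟩ : ∃ f, F = Real.exp f := ⟨_, (Real.exp_log (by linarith)).symm⟩
  obtain ⟨k, rfl⟩ : ∃ k, K = Real.exp k := ⟨_, (Real.exp_log hK).symm⟩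
  obtain ⟨e, rfl⟩ : ∃ e, E = Real.exp e := ⟨_, (Real.exp_log hE).symm⟩
  have hf : 0 ≤ f := by simpa using hF
  have hs : 0 < β + 5 * β₀ := by positivity
  -- `T = e^t` is the target. If `T > 1`, the trivial bound 2 suffices.
  set t := f * ((β + 4 * β₀) / (β + 5 * β₀)) + k * (β / (β + 5 * β₀)) + e * (2 * β₀ / (β + 5 * β₀)) with ht
  have hT : 19 * D * Real.exp f ^ ((β + 4 * β₀) / (β + 5 * β₀)) * Real.exp k ^ (β / (β + 5 * β₀)) *
      Real.exp e ^ (2 * β₀ / (β + 5 * β₀)) = 19 * D * Real.exp t := by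
    rw [← Real.exp_mul, ← Real.exp_mul, ← Real.exp_mul, ht, Real.exp_add, Real.exp_add]; ring
  rw [hT]
  have hTpos := Real.exp_pos t
  have hDT : Real.exp t ≤ D * Real.exp t := le_mul_of_one_le_left hTpos.le hD
  rcases lt_or_ge 0 t with ht0 | ht0
  · have : 1 ≤ Real.exp t := Real.one_le_exp ht0.le
    linarith
  -- `r` compares `FK` with `F^{4/5} E^{2/5}`, the balanced value without a frequency cutoff. If `r
  -- < 0` the balancing `Ω` would be negative, but then `K ≤ T` and the bound `2K` suffices.
  set r := f + k - (4 / 5 * f + 2 / 5 * e) with hr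
  rcases lt_or_ge r 0 with hr0 | hr0
  · have : k ≤ t := by
      have h3 : t - k = f * (β / (β + 5 * β₀)) + (-r + f) * (5 * β₀ / (β + 5 * β₀)) := by
        rw [ht, hr]; field_simp; ring
      have : 0 ≤ f * (β / (β + 5 * β₀)) + (-r + f) * (5 * β₀ / (β + 5 * β₀)) := by
        have : 0 ≤ -r + f := by linarith
        positivity
      linarith
    have := Real.exp_le_exp.2 this
    linarith
  · have hD0 : 0 < D := by linarith
    have hsD : 1 ≤ √D := Real.one_le_sqrt.2 hD
    set Ω := 5 * r / (β + 5 * β₀) with hΩ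
    have hexp : Real.exp (t / 2) ≤ 1 := Real.exp_le_one_iff.2 (by linarith)
    -- With `τ = √(T/D)` and `F K e^{-β₀Ω} = T`, the three terms are `16 D T`, `2 T` and `D^{1/4}
    -- T`; they sum to at most `19 D T`, whence the constant.
    have h3 := h (Real.exp (t / 2) / √D) Ω (by positivity)
      ((div_le_one (by positivity)).2 (hexp.trans hsD)) (by positivity)
    have e1 : (Real.exp (t / 2) / √D) ^ 2 * D ^ 2 = D * Real.exp t := by
      rw [div_pow, Real.sq_sqrt hD0.le, ← Real.exp_nat_mul]
      push_cast
      rw [mul_div_cancel₀ _ two_ne_zero]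
      field_simp
    have e2 : 2 * Real.exp f * Real.exp (-(β₀ * Ω)) * Real.exp k = 2 * Real.exp t := by
      rw [mul_assoc, mul_assoc, ← Real.exp_add, ← Real.exp_add]
      congr 2
      rw [hΩ, ht, hr]; field_simp; ring
    have e3 : Real.exp f * Real.exp (β * Ω / 4) * √(Real.exp e) = Real.exp (t / 4) * Real.exp t := by
      rw [← Real.exp_half, ← Real.exp_add, ← Real.exp_add, ← Real.exp_add]
      congr 1
      rw [hΩ, ht, hr]; field_simp; ring
    have e4 : √(Real.exp (t / 2) / √D) = Real.exp (t / 4) / √(√D) := by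
      rw [Real.sqrt_div (Real.exp_pos _).le, ← Real.exp_half]; congr 2; ring
    rw [e1, e2, e3, e4] at h3
    have e5 : Real.exp (t / 4) * Real.exp t / (Real.exp (t / 4) / √(√D)) = √(√D) * Real.exp t := by
      field_simp
    have h4 : √(√D) ≤ D := by
      rw [Real.sqrt_le_left hD0.le, Real.sqrt_le_left (by positivity)]
      have : D ≤ D ^ 2 := by nlinarith
      nlinarith
    have h5 : √(√D) * Real.exp t ≤ D * Real.exp t := mul_le_mul_of_nonneg_right h4 hTpos.le
    rw [e5] at h3
    linarith

theorem le_of_forall_cutoff {φ β β₀ F K E D : ℝ} (hβ : 0 < β) (hβ₀ : 0 < β₀) (hF : 1 ≤ F) (hK : 0 ≤ K)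
    (hE : 0 ≤ E) (hD : 1 ≤ D) (h2 : φ ≤ 2) (h2K : φ ≤ 2 * K)
    (h : ∀ τ Ω : ℝ, 0 < τ → τ ≤ 1 → 0 ≤ Ω →
      φ ≤ 16 * (τ ^ 2 * D ^ 2) + 2 * F * Real.exp (-(β₀ * Ω)) * K + F * Real.exp (β * Ω / 4) * √E / √τ) :
    φ ≤ 19 * D * F ^ ((β + 4 * β₀) / (β + 5 * β₀)) * K ^ (β / (β + 5 * β₀)) *
      E ^ (2 * β₀ / (β + 5 * β₀)) := by
  rcases hK.eq_or_lt with rfl | hK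
  · rw [mul_zero] at h2K
    exact h2K.trans (by positivity)
  have hc : Filter.Tendsto (fun E' : ℝ => 19 * D * F ^ ((β + 4 * β₀) / (β + 5 * β₀)) *
      K ^ (β / (β + 5 * β₀)) * E' ^ (2 * β₀ / (β + 5 * β₀))) (nhdsWithin E (Set.Ioi E))
      (nhds (19 * D * F ^ ((β + 4 * β₀) / (β + 5 * β₀)) * K ^ (β / (β + 5 * β₀)) *
        E ^ (2 * β₀ / (β + 5 * β₀)))) := by
    refine Filter.Tendsto.mono_left (Continuous.tendsto ?_ E) nhdsWithin_le_nhds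
    exact continuous_const.mul (Real.continuous_rpow_const (by positivity))
  -- The optimization takes `log E`, so `E = 0` is reached as a limit from above; the hypothesis is
  -- monotone in `E`.
  refine ge_of_tendsto hc (Filter.eventually_of_mem self_mem_nhdsWithin fun E' (hE' : E < E') => ?_)
  refine le_of_forall_cutoff_of_pos hβ hβ₀ hF hK (hE.trans_lt hE') hD h2 h2K fun τ Ω hτ hτ1 hΩ => ?_
  refine (h τ Ω hτ hτ1 hΩ).trans (add_le_add le_rfl ?_)
  gcongr

end Optimization

end GibbsSampler

end

theorem mainTheorem5 :
    ∃ C : ℝ, 0 < C ∧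
      ∀ (Λ Γ : Type*) [Fintype Λ] [DecidableEq Λ] [Fintype Γ]
        (h : GibbsSampler.LocalHamiltonian Λ Γ) (d : ℕ) (β β₀ σ : ℝ)
        (A O : GibbsSampler.QubitOp Λ),
        1 ≤ d → h.interactionDegree ≤ d → 0 < β → 0 < β₀ → 0 < σ →
        A.IsHermitian → ‖A‖ ≤ 1 → ‖O‖ ≤ 1 →
        0 ≤ GibbsSampler.dirichletForm h.isHermitian_total β σ A O O ∧
        GibbsSampler.kmsNorm (GibbsSampler.gibbs h.total β) (A * O - O * A) ≤
          C * ((d : ℝ) ^ 2 * ((GibbsSampler.opSupport A).card : ℝ)) *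
            (Real.exp (σ ^ 2 * β₀ ^ 2) / (β₀ * σ) +
              Real.exp (σ ^ 2 * β ^ 2 / 16) / √(GibbsSampler.gKernel β 1 * β * σ)) ^
                ((β + 4 * β₀) / (β + 5 * β₀)) *
            (‖GibbsSampler.gibbs h.total β₀ * A * (GibbsSampler.gibbs h.total β₀)⁻¹‖ +
              ‖(GibbsSampler.gibbs h.total β₀)⁻¹ * A * GibbsSampler.gibbs h.total β₀‖) ^
                (β / (β + 5 * β₀)) *
            (GibbsSampler.dirichletForm h.isHermitian_total β σ A O O).re ^
              (2 * β₀ / (β + 5 * β₀)) := by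
  refine ⟨19, by norm_num, fun Λ Γ _ _ _ h d β β₀ σ A O hd hdeg hβ hβ₀ hσ hA hA1 hO1 => ?_⟩
  have hE := GibbsSampler.dirichletForm_self_nonneg h.isHermitian_total hβ hσ hA O
  refine ⟨hE, ?_⟩
  have hE0 := (Complex.le_def.1 hE).1
  rw [Complex.zero_re] at hE0
  -- With empty support the right-hand side is zero, but `A` commutes with `O`. Otherwise `d²|A| ≥
  -- 1`, as the optimization requires.
  rcases Nat.eq_zero_or_pos (GibbsSampler.opSupport A).card with hc | hc
  · have hcomm : Commute A O := GibbsSampler.commute_of_disjoint_opSupport (by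
      rw [Finset.card_eq_zero.1 hc, Finset.empty_inter])
    rw [hcomm.eq, sub_self, hc]
    simp [GibbsSampler.kmsNorm, GibbsSampler.kmsInner]
  have hd1 : (1 : ℝ) ≤ d := by exact_mod_cast hd
  have hc1 : (1 : ℝ) ≤ (GibbsSampler.opSupport A).card := by exact_mod_cast hc
  have hD : (1 : ℝ) ≤ (d : ℝ) ^ 2 * (GibbsSampler.opSupport A).card :=
    one_le_mul_of_one_le_of_one_le (one_le_pow₀ hd1) hc1
  have hQ : 0 ≤ Real.exp (σ ^ 2 * β ^ 2 / 16) / √(GibbsSampler.gKernel β 1 * β * σ) := by positivity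
  -- With `x = β₀σ`: `e^{x²} ≥ 1 + x² ≥ 2x ≥ x`. This supplies `F ≥ 1`.
  have hP : 1 ≤ Real.exp (σ ^ 2 * β₀ ^ 2) / (β₀ * σ) := by
    rw [one_le_div (by positivity)]
    have := Real.add_one_le_exp (σ ^ 2 * β₀ ^ 2)
    nlinarith [sq_nonneg (β₀ * σ - 1)]
  have htriv : GibbsSampler.kmsNorm (GibbsSampler.gibbs h.total β) (A * O - O * A) ≤ 2 * ‖A‖ := by
    rw [← GibbsSampler.norm_kmsEmbed h.isHermitian_total]
    exact GibbsSampler.norm_commEmbed_le h.isHermitian_total β hO1 A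
  have hconj : ‖A‖ ≤ ‖GibbsSampler.gibbs h.total β₀ * A * (GibbsSampler.gibbs h.total β₀)⁻¹‖ +
      ‖(GibbsSampler.gibbs h.total β₀)⁻¹ * A * GibbsSampler.gibbs h.total β₀‖ :=
    (GibbsSampler.norm_le_norm_conj hA (GibbsSampler.isUnit_gibbs h.isHermitian_total β₀)).trans
      (le_add_of_nonneg_right (norm_nonneg _))
  have hM := h.norm_double_commutator_le hd hdeg hA1 hc
  have hcut := fun (τ Ω : ℝ) (hτ : 0 < τ) (hτ1 : τ ≤ 1) (hΩ : 0 ≤ Ω) =>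
    GibbsSampler.kmsNorm_commutator_le h.isHermitian_total hβ hβ₀ hσ hτ hτ1 hΩ hA hO1
  generalize (GibbsSampler.dirichletForm h.isHermitian_total β σ A O O).re = E at *
  generalize ‖GibbsSampler.gibbs h.total β₀ * A * (GibbsSampler.gibbs h.total β₀)⁻¹‖ +
      ‖(GibbsSampler.gibbs h.total β₀)⁻¹ * A * GibbsSampler.gibbs h.total β₀‖ = K at *
  generalize GibbsSampler.kmsNorm (GibbsSampler.gibbs h.total β) (A * O - O * A) = φ at *
  generalize (d : ℝ) ^ 2 * (GibbsSampler.opSupport A).card = D at *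
  generalize Real.exp (σ ^ 2 * β₀ ^ 2) / (β₀ * σ) = P at *
  generalize Real.exp (σ ^ 2 * β ^ 2 / 16) / √(GibbsSampler.gKernel β 1 * β * σ) = Q at *
  have hK0 : 0 ≤ K := (norm_nonneg A).trans hconj
  refine GibbsSampler.le_of_forall_cutoff hβ hβ₀ (by linarith) hK0 hE0 hD (by linarith) (by linarith)
    fun τ Ω hτ hτ1 hΩ => (hcut τ Ω hτ hτ1 hΩ).trans (add_le_add (add_le_add ?_ ?_) ?_)
  · have := mul_le_mul_of_nonneg_left hM (sq_nonneg τ)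
    linarith
  · gcongr
    linarith
  · gcongr
    linarith
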